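/- **Conventions.** Rings are associative with identity, not necessarily commutative. For a ring $A$, $\mathrm{Mod}\,A$ is the category of all left $A$-modules. A left $A$-module $G$ is *Gorenstein projective* if $G\cong\ker(P^0\to P^1)$ for some exact complex $\cdots\to P^{-1}\to P^0\to P^1\to\cdots$ of projective left $A$-modules such that the complex $\mathrm{Hom}_A(P^\bullet,Q)$ is exact for every projective left $A$-module $Q$; $\mathcal{GP}(A)$ is the class of Gorenstein projective left $A$-modules. A class $\mathcal X$ of left $A$-modules is *special precovering* in $\mathrm{Mod}\,A$ if for every left $A$-module $N$ there is a surjective homomorphism $f:G\to N$ with $G\in\mathcal X$ and $\mathrm{Ext}^1_A(X,\ker f)=0$ for all $X\in\mathcal X$. **Corollary 1.2 (GP precover).** Let $R$ and $S$ be rings, let ${}_RM_S$ be an $R$-$S$-bimodule, and let $\Lambda=\begin{pmatrix}R&M\\0&S\end{pmatrix}$ be the triangular matrix ring, with the usual matrix addition and multiplication. Assume that the left $R$-module ${}_RM$ has finite projective dimension and that the right $S$-module $M_S$ has finite flat dimension. Then $\mathcal{GP}(\Lambda)$ is special precovering in $\mathrm{Mod}\,\Lambda$ if and only if $\mathcal{GP}(R)$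 is special precovering in $\mathrm{Mod}\,R$ and $\mathcal{GP}(S)$ is special precovering in $\mathrm{Mod}\,S$. -/

import Mathlib

open CategoryTheory CategoryTheory.Limits
open scoped TensorProduct

universe u v w

section SpecialPrecovers

variable {C : Type u} [Category.{v} C] [Abelian C] [HasExt.{w} C]

/-- `𝒳^⊥`: the objects `N` with `Ext¹(X, N) = 0` for every `X` in the class `𝒳`. -/
def extOneRightOrthogonal (𝒳 : ObjectProperty C) : ObjectProperty C :=
  fun N => ∀ X : C, 𝒳 X → Subsingleton (Abelian.Ext.{w} X N 1)

/-- `f : G ⟶ N` is a special `𝒳`-precover of `N`: it is an epimorphism, `G` lies in `𝒳`, and the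
kernel of `f` lies in `𝒳^⊥`. -/
structure IsSpecialPrecover (𝒳 : ObjectProperty C) {G N : C} (f : G ⟶ N) : Prop where
  epi : Epi f
  source_mem : 𝒳 G
  kernel_mem : extOneRightOrthogonal.{u, v, w} 𝒳 (kernel f)

/-- The class `𝒳` is special precovering: every object has a special `𝒳`-precover. -/
def IsSpecialPrecovering (𝒳 : ObjectProperty C) : Prop :=
  ∀ N : C, ∃ (G : C) (f : G ⟶ N), IsSpecialPrecover.{u, v, w} 𝒳 f

end SpecialPrecovers

section GorensteinProjective

variable {C : Type u} [Category.{v} C] [Abelian C]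

/-- A complete projective resolution: an exact complex
`⋯ ⟶ P⁻¹ ⟶ P⁰ ⟶ P¹ ⟶ ⋯` of projective objects such that the complex of abelian groups
`Hom(P, Q)` is exact for every projective object `Q`.  Exactness of `Hom(P, Q)` at `Hom(Pⁿ⁺¹, Q)`
says that a morphism `Pⁿ⁺¹ ⟶ Q` which vanishes on precomposition with `d : Pⁿ ⟶ Pⁿ⁺¹` is
the composite of `d : Pⁿ⁺¹ ⟶ Pⁿ⁺²` with a morphism `Pⁿ⁺² ⟶ Q`. -/
structure IsCompleteProjectiveResolution (P : CochainComplex C ℤ) : Prop where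
  projective : ∀ n : ℤ, Projective (P.X n)
  acyclic : P.Acyclic
  hom_exact : ∀ Q : C, Projective Q → ∀ (n : ℤ) (f : P.X (n + 1) ⟶ Q),
    P.d n (n + 1) ≫ f = 0 → ∃ g : P.X (n + 1 + 1) ⟶ Q, P.d (n + 1) (n + 1 + 1) ≫ g = f

variable (C) in
/-- The class of Gorenstein projective objects: those isomorphic to the object of `0`-cocycles
`Z⁰(P) = ker (P⁰ ⟶ P¹)` of a complete projective resolution `P`. -/
def gorensteinProjective : ObjectProperty C :=
  fun G => ∃ P : CochainComplex C ℤ,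
    IsCompleteProjectiveResolution P ∧ Nonempty (G ≅ P.cycles 0)

end GorensteinProjective

section FlatDimension

/-- The subgroup of `M ⊗[ℤ] N` generated by the elements `m s ⊗ n - m ⊗ s n`, for a right
`S`-module `M` and a left `S`-module `N`. -/
def balancedRelations (S M N : Type*) [Ring S] [AddCommGroup M] [Module Sᵐᵒᵖ M]
    [AddCommGroup N] [Module S N] : AddSubgroup (M ⊗[ℤ] N) :=
  AddSubgroup.closure
    {t | ∃ (m : M) (s : S) (n : N),
      t = (MulOpposite.op s • m) ⊗ₜ[ℤ] n - m ⊗ₜ[ℤ] (s • n)}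

/-- The tensor product `M ⊗_S N` (an abelian group) of a right module `M` and a left module `N`
over a not necessarily commutative ring `S`. -/
abbrev BalancedTensor (S M N : Type*) [Ring S] [AddCommGroup M] [Module Sᵐᵒᵖ M]
    [AddCommGroup N] [Module S N] : Type _ :=
  (M ⊗[ℤ] N) ⧸ balancedRelations S M N

/-- The homomorphism `M ⊗_S f : M ⊗_S N → M ⊗_S N'`, `m ⊗ n ↦ m ⊗ f n`. -/
def BalancedTensor.map {S : Type*} (M : Type*) {N N' : Type*} [Ring S] [AddCommGroup M]
    [Module Sᵐᵒᵖ M] [AddCommGroup N] [Module S N] [AddCommGroup N'] [Module S N']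
    (f : N →ₗ[S] N') : BalancedTensor S M N →+ BalancedTensor S M N' :=
  QuotientAddGroup.map (balancedRelations S M N) (balancedRelations S M N')
    (LinearMap.lTensor M (f.toAddMonoidHom.toIntLinearMap)).toAddMonoidHom (by
      rw [balancedRelations, AddSubgroup.closure_le]
      rintro _ ⟨m, s, n, rfl⟩
      refine AddSubgroup.subset_closure ⟨m, s, f n, ?_⟩
      simp)

/-- The right `S`-module `F` is flat: `F ⊗_S -` preserves injectivity of homomorphisms of left
`S`-modules. -/
def IsFlatRightModule (S : Type u) [Ring S] (F : Type u) [AddCommGroup F] [Module Sᵐᵒᵖ F] :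
    Prop :=
  ∀ (N N' : Type u) [AddCommGroup N] [Module S N] [AddCommGroup N'] [Module S N']
    (f : N →ₗ[S] N'), Function.Injective f → Function.Injective (BalancedTensor.map F f)

/-- The right `S`-module `M` has flat dimension at most `n`, that is, there is an exact sequence
`0 → Fₙ → ⋯ → F₁ → F₀ → M → 0` of right `S`-modules with all `Fᵢ` flat.  The sequence is built
one syzygy at a time: there are a flat `F₀` and a surjection `F₀ → M` whose kernel has
flat dimension at most `n - 1`. -/
def HasFlatDimensionLE (S : Type u) [Ring S] :
    ℕ → (M : Type u) → [AddCommGroup M] → [Module Sᵐᵒᵖ M] → Prop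
  | 0, M, _, _ => IsFlatRightModule S M
  | n + 1, M, _, _ =>
    ∃ (F : Type u) (_ : AddCommGroup F) (_ : Module Sᵐᵒᵖ F) (p : F →ₗ[Sᵐᵒᵖ] M),
      IsFlatRightModule S F ∧ Function.Surjective p ∧ HasFlatDimensionLE S n (LinearMap.ker p)

end FlatDimension

/-- The formal triangular matrix ring with diagonal entries in `R` and `S`, upper right entry in
the `R`-`S`-bimodule `M`, and lower left entry `0`. -/
@[ext]
structure TriangularMatrixRing (R M S : Type*) where
  /-- The upper left entry. -/
  a : R
  /-- The upper right entry. -/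
  m : M
  /-- The lower right entry. -/
  b : S

namespace TriangularMatrixRing

variable {R M S : Type*} [Ring R] [Ring S] [AddCommGroup M]

instance : Zero (TriangularMatrixRing R M S) := ⟨⟨0, 0, 0⟩⟩
instance : One (TriangularMatrixRing R M S) := ⟨⟨1, 0, 1⟩⟩
instance : Add (TriangularMatrixRing R M S) := ⟨fun x y => ⟨x.a + y.a, x.m + y.m, x.b + y.b⟩⟩
instance : Neg (TriangularMatrixRing R M S) := ⟨fun x => ⟨-x.a, -x.m, -x.b⟩⟩

@[simp] lemma zero_a : (0 : TriangularMatrixRing R M S).a = 0 := rfl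
@[simp] lemma zero_m : (0 : TriangularMatrixRing R M S).m = 0 := rfl
@[simp] lemma zero_b : (0 : TriangularMatrixRing R M S).b = 0 := rfl
@[simp] lemma one_a : (1 : TriangularMatrixRing R M S).a = 1 := rfl
@[simp] lemma one_m : (1 : TriangularMatrixRing R M S).m = 0 := rfl
@[simp] lemma one_b : (1 : TriangularMatrixRing R M S).b = 1 := rfl
@[simp] lemma add_a (x y : TriangularMatrixRing R M S) : (x + y).a = x.a + y.a := rfl
@[simp] lemma add_m (x y : TriangularMatrixRing R M S) : (x + y).m = x.m + y.m := rfl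
@[simp] lemma add_b (x y : TriangularMatrixRing R M S) : (x + y).b = x.b + y.b := rfl
@[simp] lemma neg_a (x : TriangularMatrixRing R M S) : (-x).a = -x.a := rfl
@[simp] lemma neg_m (x : TriangularMatrixRing R M S) : (-x).m = -x.m := rfl
@[simp] lemma neg_b (x : TriangularMatrixRing R M S) : (-x).b = -x.b := rfl

variable [Module R M] [Module Sᵐᵒᵖ M]

/-- Matrix multiplication: the upper right entry of `x * y` is `x.a y.m + x.m y.b`, where the right
action of `S` on `M` is written as a left action of `Sᵐᵒᵖ`. -/
instance : Mul (TriangularMatrixRing R M S) :=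
  ⟨fun x y => ⟨x.a * y.a, x.a • y.m + MulOpposite.op y.b • x.m, x.b * y.b⟩⟩

@[simp] lemma mul_a (x y : TriangularMatrixRing R M S) : (x * y).a = x.a * y.a := rfl
@[simp] lemma mul_m (x y : TriangularMatrixRing R M S) :
    (x * y).m = x.a • y.m + MulOpposite.op y.b • x.m := rfl
@[simp] lemma mul_b (x y : TriangularMatrixRing R M S) : (x * y).b = x.b * y.b := rfl

instance [SMulCommClass R Sᵐᵒᵖ M] : Ring (TriangularMatrixRing R M S) where
  add_assoc x y z := by ext <;> simp [add_assoc]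
  zero_add x := by ext <;> simp
  add_zero x := by ext <;> simp
  add_comm x y := by ext <;> simp [add_comm]
  neg_add_cancel x := by ext <;> simp
  nsmul := nsmulRec
  zsmul := zsmulRec
  left_distrib x y z := by
    ext
    · simp [mul_add]
    · simp only [mul_m, add_m, add_b, MulOpposite.op_add, add_smul, smul_add]; abel
    · simp [mul_add]
  right_distrib x y z := by
    ext
    · simp [add_mul]
    · simp only [mul_m, add_a, add_m, add_smul, smul_add]; abel
    · simp [add_mul]
  zero_mul x := by ext <;> simp
  mul_zero x := by ext <;> simp
  mul_assoc x y z := by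
    ext
    · simp [mul_assoc]
    · simp only [mul_m, mul_a, mul_b, smul_add, mul_smul, MulOpposite.op_mul,
        smul_comm x.a (MulOpposite.op z.b) y.m, add_assoc]
    · simp [mul_assoc]
  one_mul x := by ext <;> simp
  mul_one x := by ext <;> simp

end TriangularMatrixRing

/-!
The argument rests on an intrinsic description of Gorenstein projective objects: they form the
largest class whose members `X` satisfy `Ext¹(X, Q) = 0` for projective `Q` and fit into short exact
sequences `0 → X → P → X' → 0` and `0 → X'' → P → X → 0` with `P` projective and `X'`, `X''` in the
class (`IsGorensteinClass.le`, `isGorensteinClass_gorensteinProjective`). To show that a functor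
maps Gorenstein projective objects to Gorenstein projective ones it is therefore enough to check
that its image is such a class, and no complexes have to be handled.

A module over the triangular matrix ring `Λ` is a triple of an `R`-module `X`, an `S`-module `Y` and
a homomorphism `M ⊗ Y → X`. The proof uses only the functors between the three module categories,
axiomatized in `TriangularGluing`: the embeddings `i X = (X, 0)` and `j Y = (0, Y)`, the parts
`e (X, Y) = X` and `q (X, Y) = Y`, and `t Y = (M ⊗ Y, Y)`, with adjunctions `i ⊣ e` and `t ⊣ q ⊣ j`.
Two finiteness conditions enter (`TriangularGluing.IsCompatible`). The part `e Q` of a projective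
`Λ`-module is a summand of a sum of copies of `R × M`, so it has finite projective dimension and
receives no extensions from Gorenstein projective modules. And `t` is exact on short exact sequences
whose last term is Gorenstein projective: by Lambek's theorem the character module of `M` has finite
injective dimension, hence receives no extensions from Gorenstein projective modules.

Under these conditions, if `W` is Gorenstein projective, then `t (q W) → W` is injective, its
cokernel has the form `i G`, and `q W` and `G` are Gorenstein projective
(`mono_counit_of_gorensteinProjective`, `gorensteinProjective_q`, `gorensteinProjective_of_isSES`);
conversely `i` and `t` preserve Gorenstein projectives. Consequently `N` lies in the orthogonal
class if and only if `e N` and `q N` do (`orthogonal_of_parts`, `orthogonal_e`, `orthogonal_q`).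

Precovers over `Λ` give precovers over `S` by applying `q` to a precover of `j Y`, and over `R` by
passing from a precover `W → i X` to the cokernel of `t (q W) → W`. In the other direction, a
precover of `q N` and an epimorphism from a projective module onto `e N` yield an epimorphism onto
`N` from a Gorenstein projective module; its kernel is corrected by a pushout along a special
preenvelope of the part `e` of the kernel, which exists by Salce's lemma.
-/

/-! ### Short exact sequences -/

section ShortExactSequences

variable {C : Type u} [Category.{v} C] [Abelian C]

/-- `0 ⟶ X ⟶ Y ⟶ Z ⟶ 0` is a short exact sequence. -/
def IsSES {X Y Z : C} (f : X ⟶ Y) (g : Y ⟶ Z) : Prop :=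
  ∃ w : f ≫ g = 0, (ShortComplex.mk f g w).ShortExact

namespace IsSES

variable {X Y Z : C} {f : X ⟶ Y} {g : Y ⟶ Z}

lemma w (h : IsSES f g) : f ≫ g = 0 := h.choose

lemma shortExact (h : IsSES f g) : (ShortComplex.mk f g h.w).ShortExact := h.choose_spec

lemma mono (h : IsSES f g) : Mono f := h.shortExact.mono_f

lemma epi (h : IsSES f g) : Epi g := h.shortExact.epi_g

lemma exists_lift (h : IsSES f g) {T : C} (k : T ⟶ Y) (hk : k ≫ g = 0) :
    ∃ l : T ⟶ X, l ≫ f = k :=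
  have := h.mono
  ⟨h.shortExact.exact.lift k hk, h.shortExact.exact.lift_f k hk⟩

lemma exists_desc (h : IsSES f g) {T : C} (k : Y ⟶ T) (hk : f ≫ k = 0) :
    ∃ l : Z ⟶ T, g ≫ l = k :=
  have := h.epi
  ⟨h.shortExact.exact.desc k hk, h.shortExact.exact.g_desc k hk⟩

lemma mk_of_lift (w : f ≫ g = 0) [Mono f] [Epi g]
    (h : ∀ {T : C} (k : T ⟶ Y), k ≫ g = 0 → ∃ l : T ⟶ X, l ≫ f = k) : IsSES f g :=
  ⟨w, { exact := ShortComplex.exact_of_f_is_kernel _ (KernelFork.IsLimit.ofι' f w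
          fun k hk => ⟨(h k hk).choose, (h k hk).choose_spec⟩) }⟩

lemma mk_of_desc (w : f ≫ g = 0) [Mono f] [Epi g]
    (h : ∀ {T : C} (k : Y ⟶ T), f ≫ k = 0 → ∃ l : Z ⟶ T, g ≫ l = k) : IsSES f g :=
  ⟨w, { exact := ShortComplex.exact_of_g_is_cokernel _ (CokernelCofork.IsColimit.ofπ' g w
          fun k hk => ⟨(h k hk).choose, (h k hk).choose_spec⟩) }⟩

lemma op (h : IsSES f g) : IsSES g.op f.op := ⟨_, h.shortExact.op⟩

lemma unop {X Y Z : Cᵒᵖ} {f : X ⟶ Y} {g : Y ⟶ Z} (h : IsSES f g) : IsSES g.unop f.unop :=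
  ⟨_, h.shortExact.unop⟩

lemma of_epi (g : Y ⟶ Z) [Epi g] : IsSES (kernel.ι g) g :=
  mk_of_lift (by simp) fun k hk => ⟨kernel.lift _ k hk, by simp⟩

lemma of_mono (f : X ⟶ Y) [Mono f] : IsSES f (cokernel.π f) :=
  mk_of_desc (by simp) fun k hk => ⟨cokernel.desc _ k hk, by simp⟩

lemma of_iso {X' Y' Z' : C} {f' : X' ⟶ Y'} {g' : Y' ⟶ Z'} (h : IsSES f g) (a : X ≅ X')
    (b : Y ≅ Y') (c : Z ≅ Z') (hf : a.hom ≫ f' = f ≫ b.hom) (hg : b.hom ≫ g' = g ≫ c.hom) :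
    IsSES f' g' := by
  have w : f' ≫ g' = 0 := by
    rw [← cancel_epi a.hom, reassoc_of% hf, hg, reassoc_of% h.w]; simp
  exact ⟨w, ShortComplex.shortExact_of_iso (ShortComplex.isoMk a b c hf hg) h.shortExact⟩

lemma biprod (X Y : C) : IsSES (biprod.inl : X ⟶ X ⊞ Y) biprod.snd :=
  mk_of_lift (by simp) fun k hk => ⟨k ≫ biprod.fst, by
    ext <;> simp [hk]⟩

lemma id_zero (X : C) {Z : C} (hZ : IsZero Z) : IsSES (𝟙 X) (0 : X ⟶ Z) := by
  have : Epi (0 : X ⟶ Z) := ⟨fun _ _ _ => hZ.eq_of_src _ _⟩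
  exact mk_of_lift (by simp) fun k _ => ⟨k, by simp⟩

lemma zero_id (X : C) {Z : C} (hZ : IsZero Z) : IsSES (0 : Z ⟶ X) (𝟙 X) := by
  have : Mono (0 : Z ⟶ X) := ⟨fun _ _ _ => hZ.eq_of_tgt _ _⟩
  exact mk_of_desc (by simp) fun k _ => ⟨k, by simp⟩

/-- The cobase change of a short exact sequence along a morphism out of its first term. -/
lemma of_isPushout (h : IsSES f g) {E W : C} {k : X ⟶ E} {k' : Y ⟶ W} {f' : E ⟶ W}
    (sq : IsPushout f k k' f') : ∃ g' : W ⟶ Z, IsSES f' g' ∧ k' ≫ g' = g := by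
  have := h.mono
  have := h.epi
  have hm : Mono f' := (MorphismProperty.monomorphisms C).of_isPushout sq.flip
    (MorphismProperty.monomorphisms.infer_property f)
  obtain ⟨g', he, h0⟩ : ∃ g', k' ≫ g' = g ∧ f' ≫ g' = 0 :=
    ⟨sq.desc g 0 (by simp [h.w]), by simp, by simp⟩
  have : Epi g' := epi_of_epi_fac he
  refine ⟨g', mk_of_desc h0 fun l hl => ?_, he⟩
  obtain ⟨m, hm⟩ := h.exists_desc (k' ≫ l) (by rw [sq.w_assoc, hl, comp_zero])
  exact ⟨m, sq.hom_ext (by rw [reassoc_of% he, hm]) (by rw [reassoc_of% h0, zero_comp, hl])⟩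

/-- The base change of a short exact sequence along a morphism into its last term. -/
lemma of_isPullback (h : IsSES f g) {E W : C} {k : E ⟶ Z} {k' : W ⟶ Y} {g' : W ⟶ E}
    (sq : IsPullback k' g' g k) : ∃ f' : X ⟶ W, IsSES f' g' ∧ f' ≫ k' = f := by
  obtain ⟨f', h', e⟩ := h.op.of_isPushout sq.op.flip
  exact ⟨f'.unop, h'.unop, Quiver.Hom.op_inj e⟩

/-- The nine lemma: if the first two rows and all columns are short exact, then so is the
induced third row. -/
lemma nine {X₁ X₂ X₃ Y₁ Y₂ Y₃ Z₁ Z₂ Z₃ : C} {f₁ : X₁ ⟶ X₂} {g₁ : X₂ ⟶ X₃}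
    {f₂ : Y₁ ⟶ Y₂} {g₂ : Y₂ ⟶ Y₃} {a₁ : X₁ ⟶ Y₁} {a₂ : X₂ ⟶ Y₂} {a₃ : X₃ ⟶ Y₃}
    {b₁ : Y₁ ⟶ Z₁} {b₂ : Y₂ ⟶ Z₂} {b₃ : Y₃ ⟶ Z₃}
    (r₁ : IsSES f₁ g₁) (r₂ : IsSES f₂ g₂) (c₁ : IsSES a₁ b₁) (c₂ : IsSES a₂ b₂) (c₃ : IsSES a₃ b₃)
    (hf : f₁ ≫ a₂ = a₁ ≫ f₂) (hg : g₁ ≫ a₃ = a₂ ≫ g₂) :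
    ∃ (f₃ : Z₁ ⟶ Z₂) (g₃ : Z₂ ⟶ Z₃), IsSES f₃ g₃ ∧ f₂ ≫ b₂ = b₁ ≫ f₃ ∧ g₂ ≫ b₃ = b₂ ≫ g₃ := by
  obtain ⟨f₃, hf₃⟩ := c₁.exists_desc (f₂ ≫ b₂) (by rw [← reassoc_of% hf, c₂.w, comp_zero])
  obtain ⟨g₃, hg₃⟩ := c₂.exists_desc (g₂ ≫ b₃) (by rw [← reassoc_of% hg, c₃.w, comp_zero])
  have := r₁.epi
  have := r₂.epi
  have := r₂.mono
  have := c₁.epi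
  have := c₂.epi
  have := c₃.epi
  have := c₃.mono
  have : Epi (b₂ ≫ g₃) := by rw [hg₃]; infer_instance
  have : Epi g₃ := epi_of_epi b₂ g₃
  have w : f₃ ≫ g₃ = 0 := by
    rw [← cancel_epi b₁, reassoc_of% hf₃, hg₃, reassoc_of% r₂.w]; simp
  have hm : Mono f₃ := by
    refine Preadditive.mono_of_cancel_zero _ fun {T} z hz => ?_
    obtain ⟨T', π, _, y, hy⟩ := surjective_up_to_refinements_of_epi b₁ z
    obtain ⟨x, hx⟩ := c₂.exists_lift (y ≫ f₂) (by
      rw [Category.assoc, ← hf₃, ← reassoc_of% hy, hz, comp_zero])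
    obtain ⟨x', hx'⟩ := r₁.exists_lift x (by
      rw [← cancel_mono a₃, Category.assoc, hg, reassoc_of% hx, r₂.w, comp_zero, zero_comp])
    have : y = x' ≫ a₁ := by
      rw [← cancel_mono f₂, ← hx, ← hx', Category.assoc, Category.assoc, hf]
    rw [← cancel_epi π, hy, this, Category.assoc, c₁.w, comp_zero, comp_zero]
  refine ⟨f₃, g₃, mk_of_desc w fun {T} k hk => ?_, hf₃.symm, hg₃.symm⟩
  obtain ⟨l, hl⟩ := r₂.exists_desc (b₂ ≫ k) (by rw [← reassoc_of% hf₃, hk, comp_zero])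
  obtain ⟨m, hm⟩ := c₃.exists_desc l (by
    rw [← cancel_epi g₁, reassoc_of% hg, hl, reassoc_of% c₂.w, zero_comp, comp_zero])
  exact ⟨m, by rw [← cancel_epi b₂, reassoc_of% hg₃, hm, hl]⟩

/-- The nine lemma with the last two rows given. -/
lemma nine' {X₁ X₂ X₃ Y₁ Y₂ Y₃ Z₁ Z₂ Z₃ : C} {f₂ : Y₁ ⟶ Y₂} {g₂ : Y₂ ⟶ Y₃}
    {f₃ : Z₁ ⟶ Z₂} {g₃ : Z₂ ⟶ Z₃} {a₁ : X₁ ⟶ Y₁} {a₂ : X₂ ⟶ Y₂} {a₃ : X₃ ⟶ Y₃}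
    {b₁ : Y₁ ⟶ Z₁} {b₂ : Y₂ ⟶ Z₂} {b₃ : Y₃ ⟶ Z₃}
    (r₂ : IsSES f₂ g₂) (r₃ : IsSES f₃ g₃) (c₁ : IsSES a₁ b₁) (c₂ : IsSES a₂ b₂) (c₃ : IsSES a₃ b₃)
    (hf : f₂ ≫ b₂ = b₁ ≫ f₃) (hg : g₂ ≫ b₃ = b₂ ≫ g₃) :
    ∃ (f₁ : X₁ ⟶ X₂) (g₁ : X₂ ⟶ X₃), IsSES f₁ g₁ := by
  obtain ⟨f, g, h, -⟩ := nine r₃.op r₂.op c₃.op c₂.op c₁.op (congr_arg Quiver.Hom.op hg.symm)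
    (congr_arg Quiver.Hom.op hf.symm)
  exact ⟨_, _, h.unop⟩

end IsSES

end ShortExactSequences

/-! ### Vanishing of `Ext` along short exact sequences -/

section Ext

open Abelian

variable {C : Type u} [Category.{v} C] [Abelian C] [HasExt.{w} C] {X Y Z : C} {f : X ⟶ Y}
  {g : Y ⟶ Z}

lemma ext_subsingleton_of_iso {X X' N N' : C} {n : ℕ} (a : X ≅ X') (b : N ≅ N')
    [Subsingleton (Ext.{w} X N n)] : Subsingleton (Ext.{w} X' N' n) := by
  refine subsingleton_of_forall_eq 0 fun x => ?_
  have h : (Ext.mk₀ a.hom).comp (x.comp (Ext.mk₀ b.inv) (add_zero n)) (zero_add n) = 0 :=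
    Subsingleton.elim _ _
  have h' := congr_arg (fun y => ((Ext.mk₀ a.inv).comp y (zero_add n)).comp
    (Ext.mk₀ b.hom) (add_zero n)) h
  simpa using h'

namespace IsSES

/-- If `Ext¹(Z, N) = 0`, then every morphism `X ⟶ N` extends to `Y`. -/
lemma exists_extension (h : IsSES f g) {N : C} [Subsingleton (Ext.{w} Z N 1)] (k : X ⟶ N) :
    ∃ l : Y ⟶ N, f ≫ l = k := by
  obtain ⟨l, hl⟩ := Ext.contravariant_sequence_exact₁ h.shortExact N (Ext.mk₀ k) (add_zero 1)
    (Subsingleton.elim _ _)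
  obtain ⟨l, rfl⟩ := Ext.mk₀_bijective _ _ |>.2 l
  rw [Ext.mk₀_comp_mk₀] at hl
  exact ⟨l, (Ext.mk₀_bijective _ _).1 hl⟩

/-- If `Y` is projective, `Ext¹(Z, N)` is the cokernel of `Hom(Y, N) ⟶ Hom(X, N)`. -/
lemma ext_one_of_extension (h : IsSES f g) [Projective Y] {N : C}
    (H : ∀ k : X ⟶ N, ∃ l : Y ⟶ N, f ≫ l = k) : Subsingleton (Ext.{w} Z N 1) := by
  refine subsingleton_of_forall_eq 0 fun x => ?_
  obtain ⟨k, rfl⟩ := Ext.contravariant_sequence_exact₃ h.shortExact N x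
    (Ext.eq_zero_of_projective _) (add_zero 1)
  obtain ⟨k, rfl⟩ := Ext.mk₀_bijective _ _ |>.2 k
  obtain ⟨l, rfl⟩ := H k
  rw [← Ext.mk₀_comp_mk₀, ← Ext.comp_assoc _ _ _ (add_zero 1) (zero_add 0) (by rfl),
    h.shortExact.extClass_comp, Ext.zero_comp]

lemma ext_middle_left (h : IsSES f g) {N : C} {n : ℕ} [Subsingleton (Ext.{w} X N n)]
    [Subsingleton (Ext.{w} Z N n)] : Subsingleton (Ext.{w} Y N n) := by
  refine subsingleton_of_forall_eq 0 fun x => ?_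
  obtain ⟨y, rfl⟩ := Ext.contravariant_sequence_exact₂ h.shortExact N x (Subsingleton.elim _ _)
  rw [Subsingleton.elim y 0, Ext.comp_zero]

lemma ext_middle_right (h : IsSES f g) {N : C} {n : ℕ} [Subsingleton (Ext.{w} N X n)]
    [Subsingleton (Ext.{w} N Z n)] : Subsingleton (Ext.{w} N Y n) := by
  refine subsingleton_of_forall_eq 0 fun x => ?_
  obtain ⟨y, rfl⟩ := Ext.covariant_sequence_exact₂ N h.shortExact x (Subsingleton.elim _ _)
  rw [Subsingleton.elim y 0, Ext.zero_comp]

lemma ext_last_right (h : IsSES f g) {N : C} {n : ℕ} [Subsingleton (Ext.{w} N Y n)]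
    [Subsingleton (Ext.{w} N X (n + 1))] : Subsingleton (Ext.{w} N Z n) := by
  refine subsingleton_of_forall_eq 0 fun x => ?_
  obtain ⟨y, rfl⟩ := Ext.covariant_sequence_exact₃ N h.shortExact x rfl (Subsingleton.elim _ _)
  rw [Subsingleton.elim y 0, Ext.zero_comp]

lemma ext_last_left (h : IsSES f g) {N : C} {n : ℕ} [Subsingleton (Ext.{w} X N n)]
    [Subsingleton (Ext.{w} Y N (n + 1))] : Subsingleton (Ext.{w} Z N (n + 1)) := by
  refine subsingleton_of_forall_eq 0 fun x => ?_
  obtain ⟨y, rfl⟩ := Ext.contravariant_sequence_exact₃ h.shortExact N x (Subsingleton.elim _ _)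
    (add_comm 1 n)
  rw [Subsingleton.elim y 0, Ext.comp_zero]

lemma ext_first_left (h : IsSES f g) {N : C} {n : ℕ} [Subsingleton (Ext.{w} Y N n)]
    [Subsingleton (Ext.{w} Z N (n + 1))] : Subsingleton (Ext.{w} X N n) := by
  refine subsingleton_of_forall_eq 0 fun x => ?_
  obtain ⟨y, rfl⟩ := Ext.contravariant_sequence_exact₁ h.shortExact N x (add_comm 1 n)
    (Subsingleton.elim _ _)
  rw [Subsingleton.elim y 0, Ext.comp_zero]

end IsSES

end Ext

/-! ### Gorenstein projective objects -/

section GorensteinClasses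

open Abelian ZeroObject

variable {C : Type u} [Category.{v} C] [Abelian C]

/-- Short exact sequences `0 ⟶ Z n ⟶ P n ⟶ Z (n + 1) ⟶ 0` splice to a complex with terms `P n`. -/
lemma exists_splice {Z P : ℤ → C} (ι : ∀ n, Z n ⟶ P n) (π : ∀ n, P n ⟶ Z (n + 1))
    (h : ∀ n, IsSES (ι n) (π n)) :
    ∃ (K : CochainComplex C ℤ) (_ : ∀ n, P n ≅ K.X n) (ι' : ∀ n, Z n ⟶ K.X n)
      (π' : ∀ n, K.X n ⟶ Z (n + 1)),
      (∀ n, IsSES (ι' n) (π' n)) ∧ ∀ n, K.d n (n + 1) = π' n ≫ ι' (n + 1) :=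
  ⟨CochainComplex.of P (fun n => π n ≫ ι (n + 1)) fun n => by
      rw [Category.assoc, reassoc_of% (h (n + 1)).w, zero_comp, comp_zero],
    fun _ => Iso.refl _, ι, π, h, fun n => CochainComplex.of_d P (fun n => π n ≫ ι (n + 1)) n⟩

section

variable {K : CochainComplex C ℤ} {Z : ℤ → C} {ι : ∀ n, Z n ⟶ K.X n} {π : ∀ n, K.X n ⟶ Z (n + 1)}
    (h : ∀ n, IsSES (ι n) (π n)) (hd : ∀ n, K.d n (n + 1) = π n ≫ ι (n + 1))

include h hd

lemma acyclic_of_splice : K.Acyclic := by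
  intro n
  obtain ⟨k, rfl⟩ : ∃ k, n = k + 1 := ⟨n - 1, by ring⟩
  rw [HomologicalComplex.exactAt_iff' _ k (k + 1) (k + 1 + 1) (by simp) (by simp),
    ShortComplex.exact_iff_exact_up_to_refinements]
  intro A (x : A ⟶ K.X (k + 1)) (hx : x ≫ K.d (k + 1) (k + 1 + 1) = 0)
  have := (h (k + 1 + 1)).mono
  have := (h k).epi
  obtain ⟨y, rfl⟩ := (h (k + 1)).exists_lift x (by
    rw [← cancel_mono (ι (k + 1 + 1)), Category.assoc, ← hd, hx, zero_comp])
  obtain ⟨A', p, hp, z, hz⟩ := surjective_up_to_refinements_of_epi (π k) y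
  refine ⟨A', p, hp, z, ?_⟩
  change p ≫ y ≫ ι (k + 1) = z ≫ K.d k (k + 1)
  rw [hd, reassoc_of% hz]

lemma cycles_iso_of_splice : Nonempty (Z 0 ≅ K.cycles 0) := by
  have := (h 0).mono
  have := (h (0 + 1)).mono
  have w : ι 0 ≫ K.d 0 (0 + 1) = 0 := by
    rw [hd, reassoc_of% (h 0).w, zero_comp]
  refine ⟨IsLimit.conePointUniqueUpToIso (KernelFork.IsLimit.ofι' (ι 0) w fun k hk => ?_)
    (K.cyclesIsKernel 0 (0 + 1) (by simp))⟩
  have e := (h 0).exists_lift k (by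
    rw [← cancel_mono (ι (0 + 1)), Category.assoc, ← hd, hk, zero_comp])
  exact ⟨e.choose, e.choose_spec⟩

end

/-- In a complete projective resolution, `0 ⟶ Zⁿ ⟶ Pⁿ ⟶ Zⁿ⁺¹ ⟶ 0` is exact. -/
lemma IsCompleteProjectiveResolution.isSES {P : CochainComplex C ℤ}
    (hP : IsCompleteProjectiveResolution P) (n : ℤ) :
    IsSES (P.iCycles n) (P.toCycles n (n + 1)) := by
  have : Epi (P.toCycles n (n + 1)) := by
    rw [epi_iff_surjective_up_to_refinements]
    intro A z
    have e := hP.acyclic (n + 1)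
    rw [HomologicalComplex.exactAt_iff' _ n (n + 1) (n + 1 + 1) (by simp) (by simp)] at e
    have w : (z ≫ P.iCycles (n + 1)) ≫ P.d (n + 1) (n + 1 + 1) = 0 := by simp
    obtain ⟨A', π, hπ, (x : A' ⟶ P.X n), hx⟩ := e.exact_up_to_refinements _ w
    replace hx : π ≫ z ≫ P.iCycles (n + 1) = x ≫ P.d n (n + 1) := hx
    exact ⟨A', π, hπ, x, by
      rw [← cancel_mono (P.iCycles (n + 1)), Category.assoc, hx, Category.assoc, P.toCycles_i]⟩
  refine IsSES.mk_of_lift (by rw [← cancel_mono (P.iCycles (n + 1))]; simp) fun k hk => ?_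
  exact ⟨P.liftCycles k (n + 1) (by simp) (by rw [← P.toCycles_i, reassoc_of% hk, zero_comp]),
    by simp⟩

variable [HasExt.{w} C]

/-- A class of objects such that every member `X` satisfies `Ext¹(X, Q) = 0` for all projective
`Q`, embeds in a projective object with cokernel in the class, and is a quotient of a projective
object with kernel in the class.  The Gorenstein projective objects form the largest such class. -/
structure IsGorensteinClass (𝒳 : ObjectProperty C) : Prop where
  ext_one : ∀ X, 𝒳 X → ∀ Q, Projective Q → Subsingleton (Ext.{w} X Q 1)
  next : ∀ X, 𝒳 X → ∃ (P X' : C) (f : X ⟶ P) (g : P ⟶ X'), Projective P ∧ 𝒳 X' ∧ IsSES f g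
  prev : ∀ X, 𝒳 X → ∃ (X' P : C) (f : X' ⟶ P) (g : P ⟶ X), Projective P ∧ 𝒳 X' ∧ IsSES f g

/-- A member of a Gorenstein class is a term of a two-sided sequence of short exact sequences with
projective middle terms. -/
lemma IsGorensteinClass.exists_sequence {𝒳 : ObjectProperty C}
    (h : IsGorensteinClass.{u, v, w} 𝒳) {X : C} (hX : 𝒳 X) : ∃ Z : ℤ → C, Z 0 = X ∧ (∀ n, 𝒳 (Z n)) ∧
      ∀ n, ∃ (P : C) (f : Z n ⟶ P) (g : P ⟶ Z (n + 1)), Projective P ∧ IsSES f g := by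
  choose P X' f g hP hX' hfg using fun X : {X // 𝒳 X} => h.next X.1 X.2
  choose Y' Q k l hQ hY' hkl using fun X : {X // 𝒳 X} => h.prev X.1 X.2
  let a : ℕ → {X // 𝒳 X} := fun n => Nat.rec ⟨X, hX⟩ (fun _ Y => ⟨X' Y, hX' Y⟩) n
  let b : ℕ → {X // 𝒳 X} := fun n => Nat.rec ⟨Y' ⟨X, hX⟩, hY' _⟩ (fun _ Y => ⟨Y' Y, hY' Y⟩) n
  let Z : ℤ → {X // 𝒳 X} := fun n => Int.rec a b n
  refine ⟨fun n => (Z n).1, rfl, fun n => (Z n).2, fun n => ?_⟩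
  match n with
  | Int.ofNat n => exact ⟨P (a n), f (a n), g (a n), hP _, hfg _⟩
  | Int.negSucc 0 => exact ⟨Q ⟨X, hX⟩, k _, l _, hQ _, hkl _⟩
  | Int.negSucc (n + 1) => exact ⟨Q (b n), k _, l _, hQ _, hkl _⟩

/-- Coinduction principle for Gorenstein projective objects: they contain every class that satisfies
their characteristic closure properties, because the short exact sequences given by `next` and
`prev` splice to a complete projective resolution. -/
theorem IsGorensteinClass.le {𝒳 : ObjectProperty C} (h : IsGorensteinClass.{u, v, w} 𝒳) :
    𝒳 ≤ gorensteinProjective C := by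
  intro X hX
  obtain ⟨Z, rfl, hZ, hs⟩ := h.exists_sequence hX
  choose P ι π hP hs using hs
  obtain ⟨K, e, ι, π, hs, hd⟩ := exists_splice ι π hs
  refine ⟨K, ⟨fun n => Projective.of_iso (e n) (hP n), acyclic_of_splice hs hd,
    fun Q hQ n f hf => ?_⟩, cycles_iso_of_splice hs hd⟩
  have := (hs n).epi
  have := h.ext_one _ (hZ (n + 1 + 1 + 1)) Q hQ
  rw [hd, Category.assoc, ← comp_zero (f := π n), cancel_epi] at hf
  obtain ⟨f', rfl⟩ := (hs (n + 1)).exists_desc f hf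
  obtain ⟨g, rfl⟩ := (hs (n + 1 + 1)).exists_extension f'
  exact ⟨g, by rw [hd, Category.assoc]⟩

variable (C) in
lemma isGorensteinClass_gorensteinProjective :
    IsGorensteinClass.{u, v, w} (gorensteinProjective C) := by
  let 𝒳 : ObjectProperty C := fun X => ∃ (P : CochainComplex C ℤ) (n : ℤ),
    IsCompleteProjectiveResolution P ∧ Nonempty (X ≅ P.cycles n)
  have h𝒳 : IsGorensteinClass.{u, v, w} 𝒳 := by
    refine ⟨fun X ⟨P, n, hP, ⟨e⟩⟩ Q hQ => ?_, fun X ⟨P, n, hP, ⟨e⟩⟩ => ?_,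
      fun X ⟨P, n, hP, ⟨e⟩⟩ => ?_⟩
    · obtain ⟨k, rfl⟩ : ∃ k, n = k + 1 + 1 + 1 := ⟨n - 3, by ring⟩
      have := hP.projective (k + 1 + 1)
      have : Subsingleton (Ext.{w} (P.cycles (k + 1 + 1 + 1)) Q 1) := by
        refine (hP.isSES (k + 1 + 1)).ext_one_of_extension fun f => ?_
        have := (hP.isSES (k + 1)).epi
        obtain ⟨g, hg⟩ := hP.hom_exact Q hQ k (P.toCycles (k + 1) (k + 1 + 1) ≫ f)
          (by rw [HomologicalComplex.d_toCycles_assoc, zero_comp])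
        refine ⟨g, ?_⟩
        rw [← cancel_epi (P.toCycles (k + 1) (k + 1 + 1)), ← hg,
          HomologicalComplex.toCycles_i_assoc]
      exact ext_subsingleton_of_iso e.symm (Iso.refl Q)
    · exact ⟨P.X n, P.cycles (n + 1), e.hom ≫ P.iCycles n, P.toCycles n (n + 1), hP.projective n,
        ⟨P, n + 1, hP, ⟨Iso.refl _⟩⟩, (hP.isSES n).of_iso e.symm (Iso.refl _) (Iso.refl _)
        (by simp) (by simp)⟩
    · obtain ⟨k, rfl⟩ : ∃ k, n = k + 1 := ⟨n - 1, by ring⟩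
      exact ⟨P.cycles k, P.X k, P.iCycles k, P.toCycles k (k + 1) ≫ e.inv, hP.projective k,
        ⟨P, k, hP, ⟨Iso.refl _⟩⟩, (hP.isSES k).of_iso (Iso.refl _) (Iso.refl _) e.symm
        (by simp) (by simp)⟩
  have hle : gorensteinProjective C ≤ 𝒳 := fun X ⟨P, hP, e⟩ => ⟨P, 0, hP, e⟩
  have heq : gorensteinProjective C = 𝒳 := le_antisymm hle h𝒳.le
  rwa [heq]

lemma gorensteinProjective_of_projective (X : C) [Projective X] : gorensteinProjective C X := by
  have h : IsGorensteinClass.{u, v, w} (C := C) fun X => Projective X := by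
    refine ⟨fun X hX Q _ => Ext.subsingleton_of_projective X Q 0, fun X hX => ?_, fun X hX => ?_⟩
    · exact ⟨X, 0, 𝟙 X, 0, hX, inferInstance, .id_zero X (isZero_zero C)⟩
    · exact ⟨0, X, 0, 𝟙 X, hX, inferInstance, .zero_id X (isZero_zero C)⟩
  exact h.le X ‹_›

/-- The class of Gorenstein projective objects is closed under extensions. -/
lemma gorensteinProjective_extension {X Y Z : C} {f : X ⟶ Y} {g : Y ⟶ Z} (h : IsSES f g)
    (hX : gorensteinProjective C X) (hZ : gorensteinProjective C Z) :
    gorensteinProjective C Y := by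
  have hG := isGorensteinClass_gorensteinProjective.{u, v, w} C
  have key : IsGorensteinClass.{u, v, w} (C := C) fun Y => ∃ (X Z : C) (f : X ⟶ Y) (g : Y ⟶ Z),
      IsSES f g ∧ gorensteinProjective C X ∧ gorensteinProjective C Z := by
    refine ⟨fun Y ⟨X, Z, f, g, h, hX, hZ⟩ Q hQ => ?_, fun Y ⟨X, Z, f, g, h, hX, hZ⟩ => ?_,
      fun Y ⟨X, Z, f, g, h, hX, hZ⟩ => ?_⟩
    · have := hG.ext_one X hX Q hQ
      have := hG.ext_one Z hZ Q hQ
      exact h.ext_middle_left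
    · obtain ⟨P, X', i, p, hP, hX', hi⟩ := hG.next X hX
      obtain ⟨Q, Z', j, q, hQ, hZ', hj⟩ := hG.next Z hZ
      have := hG.ext_one Z hZ P hP
      obtain ⟨k, hk⟩ := h.exists_extension i
      have := hi.mono
      have := hj.mono
      have hm : Mono (biprod.lift k (g ≫ j)) := by
        refine Preadditive.mono_of_cancel_zero _ fun y hy => ?_
        have h₁ : y ≫ k = 0 := by simpa using hy =≫ biprod.fst
        have h₂ : y ≫ g ≫ j = 0 := by simpa using hy =≫ biprod.snd
        obtain ⟨x, rfl⟩ := h.exists_lift y (by rw [← cancel_mono j, Category.assoc, h₂, zero_comp])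
        rw [Category.assoc, hk] at h₁
        rw [zero_of_comp_mono i h₁, zero_comp]
      obtain ⟨f', g', h', -⟩ := IsSES.nine h (IsSES.biprod P Q) hi
        (.of_mono (biprod.lift k (g ≫ j))) hj (by ext <;> simp [hk, reassoc_of% h.w]) (by simp)
      exact ⟨P ⊞ Q, _, _, _, inferInstance, ⟨_, _, f', g', h', hX', hZ'⟩, .of_mono _⟩
    · obtain ⟨X', P, i, p, hP, hX', hi⟩ := hG.prev X hX
      obtain ⟨Z', Q, j, q, hQ, hZ', hj⟩ := hG.prev Z hZ
      have := h.epi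
      have := hi.epi
      have := hj.epi
      have := h.mono
      let k : Q ⟶ Y := Projective.factorThru q g
      have hk : k ≫ g = q := Projective.factorThru_comp q g
      have he : Epi (biprod.desc (p ≫ f) k) := by
        refine Preadditive.epi_of_cancel_zero _ fun y hy => ?_
        have h₁ : p ≫ f ≫ y = 0 := by simpa using biprod.inl ≫= hy
        have h₂ : k ≫ y = 0 := by simpa using biprod.inr ≫= hy
        obtain ⟨z, rfl⟩ := h.exists_desc y (by rw [← cancel_epi p, h₁, comp_zero])
        rw [reassoc_of% hk] at h₂
        rw [zero_of_epi_comp q h₂, comp_zero]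
      obtain ⟨f', g', h'⟩ := IsSES.nine' (IsSES.biprod P Q) h hi (.of_epi (biprod.desc (p ≫ f) k))
        hj (by simp) (by ext <;> simp [hk, h.w])
      exact ⟨_, P ⊞ Q, _, _, inferInstance, ⟨_, _, f', g', h', hX', hZ'⟩, .of_epi _⟩
  exact key.le Y ⟨X, Z, f, g, h, hX, hZ⟩

lemma ext_gorensteinProjective_projective {X Q : C} (hX : gorensteinProjective C X)
    [hQ : Projective Q] (k : ℕ) : Subsingleton (Ext.{w} X Q (k + 1)) := by
  have hG := isGorensteinClass_gorensteinProjective.{u, v, w} C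
  induction k generalizing X with
  | zero => exact hG.ext_one X hX Q hQ
  | succ k ih =>
    obtain ⟨X', P, f, g, hP, hX', h⟩ := hG.prev X hX
    have := ih hX'
    have := Ext.subsingleton_of_projective P Q (k + 1)
    exact h.ext_last_left

lemma ext_gorensteinProjective_of_hasProjectiveDimensionLE [EnoughProjectives C] {X N : C}
    (hX : gorensteinProjective C X) (n : ℕ) (hN : HasProjectiveDimensionLE N n) (k : ℕ) :
    Subsingleton (Ext.{w} X N (k + 1)) := by
  induction n generalizing N k with
  | zero =>
    have := projective_iff_hasProjectiveDimensionLE_zero N |>.2 hN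
    exact ext_gorensteinProjective_projective hX k
  | succ n ih =>
    have h := IsSES.of_epi (Projective.π N)
    have := ext_gorensteinProjective_projective.{u, v, w} hX (Q := Projective.over N) k
    have := ih ((h.shortExact.hasProjectiveDimensionLT_X₃_iff n inferInstance).1 hN) (k + 1)
    exact h.ext_last_right

lemma ext_gorensteinProjective_of_hasInjectiveDimensionLE {X N : C}
    (hX : gorensteinProjective C X) (n : ℕ) [HasInjectiveDimensionLE N n] (k : ℕ) :
    Subsingleton (Ext.{w} X N (k + 1)) := by
  suffices ∀ m, n ≤ m + k → Subsingleton (Ext.{w} X N (k + 1)) from this n (by omega)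
  intro m
  induction m generalizing k X with
  | zero => exact fun hk => HasInjectiveDimensionLT.subsingleton N (n + 1) _ (by omega) X
  | succ m ih =>
    intro hk
    obtain ⟨P, X', f, g, hP, hX', h⟩ :=
      (isGorensteinClass_gorensteinProjective.{u, v, w} C).next X hX
    have := ih hX' (k + 1) (by omega)
    have := Ext.subsingleton_of_projective P N k
    exact h.ext_first_left

/-- A Gorenstein projective object of the orthogonal class is projective: its embedding in a
projective object with Gorenstein projective cokernel splits. -/
lemma projective_of_gorensteinProjective_of_orthogonal {X : C} (hX : gorensteinProjective C X)
    (h : extOneRightOrthogonal.{u, v, w} (gorensteinProjective C) X) : Projective X := by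
  obtain ⟨P, X', f, g, hP, hX', hf⟩ :=
    (isGorensteinClass_gorensteinProjective.{u, v, w} C).next X hX
  have := h X' hX'
  obtain ⟨r, hr⟩ := hf.exists_extension (𝟙 X)
  exact Retract.projective ⟨f, r, hr⟩

/-- Salce's lemma: if the class `𝒳` is special precovering, then every object embeds in an object
of `𝒳^⊥` with cokernel in `𝒳`. -/
lemma IsSpecialPrecovering.exists_preenvelope [EnoughInjectives C] {𝒳 : ObjectProperty C}
    (h : IsSpecialPrecovering.{u, v, w} 𝒳) (N : C) :
    ∃ (E G : C) (f : N ⟶ E) (g : E ⟶ G), IsSES f g ∧ 𝒳 G ∧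
      extOneRightOrthogonal.{u, v, w} 𝒳 E := by
  have hI := IsSES.of_mono (Injective.ι N)
  obtain ⟨G, p, hp, hG, hK⟩ := h (cokernel (Injective.ι N))
  have sq := IsPullback.of_hasPullback (cokernel.π (Injective.ι N)) p
  obtain ⟨f, hf, -⟩ := hI.of_isPullback sq
  obtain ⟨f', hf', -⟩ := (IsSES.of_epi p).of_isPullback sq.flip
  refine ⟨_, G, f, _, hf, hG, fun X hX => ?_⟩
  have := hK X hX
  have := Ext.subsingleton_of_injective X (Injective.under N) 0
  exact hf'.ext_middle_right

end GorensteinClasses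

/-! ### Gluings of abelian categories -/

section Gluing

open Abelian

lemma IsSES.exists_iso_left {C : Type u} [Category.{v} C] [Abelian C] {X X' Y Z : C} {f : X ⟶ Y}
    {f' : X' ⟶ Y} {g : Y ⟶ Z} (h : IsSES f g) (h' : IsSES f' g) : Nonempty (X ≅ X') := by
  have := h.mono
  have := h'.mono
  obtain ⟨a, ha⟩ := h'.exists_lift f h.w
  obtain ⟨b, hb⟩ := h.exists_lift f' h'.w
  exact ⟨⟨a, b, by rw [← cancel_mono f]; simp [ha, hb], by rw [← cancel_mono f']; simp [ha, hb]⟩⟩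

lemma IsSES.isZero_middle {C : Type u} [Category.{v} C] [Abelian C] {X Y Z : C} {f : X ⟶ Y}
    {g : Y ⟶ Z} (h : IsSES f g) (hX : IsZero X) (hZ : IsZero Z) : IsZero Y :=
  h.shortExact.exact.isZero_of_both_isZero hX hZ

lemma extOneRightOrthogonal_of_iso {C : Type u} [Category.{v} C] [Abelian C] [HasExt.{w} C]
    {𝒳 : ObjectProperty C} {N N' : C} (e : N ≅ N')
    (h : extOneRightOrthogonal.{u, v, w} 𝒳 N) : extOneRightOrthogonal.{u, v, w} 𝒳 N' :=
  fun X hX => have := h X hX; ext_subsingleton_of_iso (Iso.refl X) e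

lemma ext_subsingleton_of_isZero {C : Type u} [Category.{v} C] [Abelian C] [HasExt.{w} C]
    (X : C) {N : C} (h : IsZero N) (n : ℕ) : Subsingleton (Ext.{w} X N n) :=
  have := h.hasInjectiveDimensionLT_zero
  HasInjectiveDimensionLT.subsingleton N 0 n (Nat.zero_le n) X

/-- The adjunction isomorphism on `Ext¹(-, N)`. Only one short exact sequence with projective middle
term has to be preserved by `F`, so `F` need not be exact. -/
lemma Adjunction.ext_one_iff {C D : Type u} [Category.{v} C] [Category.{v} D] [Abelian C]
    [Abelian D] [HasExt.{w} C] [HasExt.{w} D] {F : C ⥤ D} {G : D ⥤ C} (adj : F ⊣ G) {X Y Z : C}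
    {f : X ⟶ Y} {g : Y ⟶ Z} (h : IsSES f g) (h' : IsSES (F.map f) (F.map g)) [Projective Y]
    [Projective (F.obj Y)] (N : D) :
    Subsingleton (Ext.{w} (F.obj Z) N 1) ↔ Subsingleton (Ext.{w} Z (G.obj N) 1) := by
  constructor
  · intro _
    refine h.ext_one_of_extension fun k => ?_
    obtain ⟨l, hl⟩ := h'.exists_extension ((adj.homEquiv _ _).symm k)
    refine ⟨adj.homEquiv _ _ l, ?_⟩
    rw [← adj.homEquiv_naturality_left, hl, Equiv.apply_symm_apply]
  · intro _
    refine h'.ext_one_of_extension fun k => ?_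
    obtain ⟨l, hl⟩ := h.exists_extension (adj.homEquiv _ _ k)
    refine ⟨(adj.homEquiv _ _).symm l, ?_⟩
    rw [← adj.homEquiv_naturality_left_symm, hl, Equiv.symm_apply_apply]

/-- The functors relating modules over a triangular matrix ring to modules over the two diagonal
rings, in terms of abelian categories: `i` and `j` embed `A` and `B` in `C`, and `e`, `q` cut out of
an object `N` of `C` its subobject `i (e N)` and its quotient `j (q N)`. The functor `t` is left
adjoint to `q`.

For the triangular matrix ring `Λ` with entries in `R`, `M`, `S`, a `Λ`-module is a triple of an
`R`-module `X`, an `S`-module `Y` and a homomorphism `M ⊗ Y → X`. Then `A` and `B` are the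
categories of `R`-modules and of `S`-modules, `e` and `q` read off `X` and `Y`, the embeddings are
`(X, 0)` and `(0, Y)`, and `t Y = (M ⊗ Y, Y)`. -/
structure TriangularGluing (A B C : Type u) [Category.{v} A] [Category.{v} B] [Category.{v} C]
    [Abelian A] [Abelian B] [Abelian C] where
  /-- The embedding of the sub-part. -/
  i : A ⥤ C
  /-- The sub-part of an object. -/
  e : C ⥤ A
  /-- The quotient part of an object. -/
  q : C ⥤ B
  /-- The embedding of the quotient part. -/
  j : B ⥤ C
  /-- The left adjoint of the quotient part. -/
  t : B ⥤ C
  /-- The embedding `i` is left adjoint to `e`. -/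
  adjI : i ⊣ e
  /-- The functor `t` is left adjoint to `q`. -/
  adjT : t ⊣ q
  /-- The embedding `j` is right adjoint to `q`. -/
  adjJ : q ⊣ j
  full_i : i.Full
  faithful_i : i.Faithful
  full_j : j.Full
  faithful_j : j.Faithful
  additive_q : q.Additive
  isSES_i : ∀ {X Y Z : A} {f : X ⟶ Y} {g : Y ⟶ Z}, IsSES f g → IsSES (i.map f) (i.map g)
  isSES_e : ∀ {X Y Z : C} {f : X ⟶ Y} {g : Y ⟶ Z}, IsSES f g → IsSES (e.map f) (e.map g)
  isSES_q : ∀ {X Y Z : C} {f : X ⟶ Y} {g : Y ⟶ Z}, IsSES f g → IsSES (q.map f) (q.map g)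
  isSES_j : ∀ {X Y Z : B} {f : X ⟶ Y} {g : Y ⟶ Z}, IsSES f g → IsSES (j.map f) (j.map g)
  isZero_q_i : ∀ X, IsZero (q.obj (i.obj X))
  isZero_e_j : ∀ Y, IsZero (e.obj (j.obj Y))
  isSES : ∀ N, IsSES (X := i.obj (e.obj N)) (Y := N) (Z := j.obj (q.obj N)) (adjI.counit.app N)
    (adjJ.unit.app N)

namespace TriangularGluing

attribute [instance] full_i faithful_i full_j faithful_j additive_q

variable {A B C : Type u} [Category.{v} A] [Category.{v} B] [Category.{v} C]
    [Abelian A] [Abelian B] [Abelian C] (R : TriangularGluing A B C)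

lemma preservesEpimorphisms_of_isSES {C D : Type u} [Category.{v} C] [Category.{v} D] [Abelian C]
    [Abelian D] {F : C ⥤ D} (hF : ∀ {X Y Z : C} {f : X ⟶ Y} {g : Y ⟶ Z}, IsSES f g →
      IsSES (F.map f) (F.map g)) : F.PreservesEpimorphisms :=
  ⟨fun f _ => (hF (IsSES.of_epi f)).epi⟩

lemma preservesMonomorphisms_of_isSES {C D : Type u} [Category.{v} C] [Category.{v} D] [Abelian C]
    [Abelian D] {F : C ⥤ D} (hF : ∀ {X Y Z : C} {f : X ⟶ Y} {g : Y ⟶ Z}, IsSES f g →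
      IsSES (F.map f) (F.map g)) : F.PreservesMonomorphisms :=
  ⟨fun f _ => (hF (IsSES.of_mono f)).mono⟩

instance : R.e.PreservesEpimorphisms := preservesEpimorphisms_of_isSES R.isSES_e
instance : R.q.PreservesEpimorphisms := preservesEpimorphisms_of_isSES R.isSES_q
instance : R.j.PreservesEpimorphisms := preservesEpimorphisms_of_isSES R.isSES_j
instance : R.q.PreservesMonomorphisms := preservesMonomorphisms_of_isSES R.isSES_q
instance : R.i.IsLeftAdjoint := R.adjI.isLeftAdjoint
instance : R.e.IsRightAdjoint := R.adjI.isRightAdjoint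
instance : R.t.IsLeftAdjoint := R.adjT.isLeftAdjoint
instance : R.j.IsRightAdjoint := R.adjJ.isRightAdjoint

instance : IsIso R.adjT.unit :=
  (Adjunction.Triple.isIso_unit_iff_isIso_counit ⟨R.adjT, R.adjJ⟩).2 inferInstance

instance (X : A) [hX : Projective X] : Projective (R.i.obj X) := R.adjI.map_projective X hX
instance (Y : B) [hY : Projective Y] : Projective (R.t.obj Y) := R.adjT.map_projective Y hY
instance (N : C) [hN : Projective N] : Projective (R.q.obj N) := R.adjJ.map_projective N hN

/-- A morphism killed by `e` and `q` vanishes, because its image does. -/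
lemma eq_zero {N T : C} (y : N ⟶ T) (he : R.e.map y = 0) (hq : R.q.map y = 0) : y = 0 := by
  have key : IsZero (Abelian.image y) := by
    refine (R.isSES _).isZero_middle ?_ ?_
    · rw [← Abelian.image.fac y, Functor.map_comp] at he
      exact R.i.map_isZero (IsZero.of_epi_eq_zero _ (zero_of_comp_mono _ he))
    · rw [← Abelian.image.fac y, Functor.map_comp] at hq
      exact R.j.map_isZero (IsZero.of_epi_eq_zero _ (zero_of_comp_mono _ hq))
  rw [← Abelian.image.fac y, key.eq_of_tgt (Abelian.factorThruImage y) 0, zero_comp]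

lemma hom_t_i {Y : B} {X : A} (f : R.t.obj Y ⟶ R.i.obj X) : f = 0 :=
  (R.adjT.homEquiv _ _).injective ((R.isZero_q_i X).eq_of_tgt _ _)

/-- An object `N` is covered by the sum of objects from `A` and `B` that cover its parts. -/
lemma epi_desc {N : C} {X : A} {Y : B} (p : Y ⟶ R.q.obj N) (r : X ⟶ R.e.obj N) [Epi p] [Epi r] :
    Epi (biprod.desc ((R.adjT.homEquiv _ _).symm p) ((R.adjI.homEquiv _ _).symm r)) := by
  refine Preadditive.epi_of_cancel_zero _ fun {T} y hy => ?_
  have h₁ : (R.adjT.homEquiv _ _).symm p ≫ y = 0 := by simpa using biprod.inl ≫= hy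
  have h₂ : (R.adjI.homEquiv _ _).symm r ≫ y = 0 := by simpa using biprod.inr ≫= hy
  refine R.eq_zero y ?_ ?_
  · rw [← R.adjI.homEquiv_naturality_right_symm] at h₂
    have := congr_arg (R.adjI.homEquiv _ _) h₂
    rw [Equiv.apply_symm_apply, Adjunction.homEquiv_unit, Functor.map_zero, comp_zero] at this
    exact zero_of_epi_comp r this
  · rw [← R.adjT.homEquiv_naturality_right_symm] at h₁
    have := congr_arg (R.adjT.homEquiv _ _) h₁
    rw [Equiv.apply_symm_apply, Adjunction.homEquiv_unit, Functor.map_zero, comp_zero] at this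
    exact zero_of_epi_comp p this

lemma isIso_counit_t (Y : B) : IsIso (R.adjT.counit.app (R.t.obj Y)) :=
  IsIso.of_isIso_fac_left (R.adjT.left_triangle_components Y)

/-- For a projective object `Q`, the morphism `t (q Q) ⟶ Q` is a monomorphism: `Q` is a summand of
some `t Y ⊞ i X`, and only the summand `t Y` contributes to `t (q Q)`. -/
lemma mono_counit_of_projective [EnoughProjectives A] [EnoughProjectives B] (Q : C) [Projective Q] :
    Mono (R.adjT.counit.app Q) := by
  let b₁ := (R.adjT.homEquiv _ _).symm (Projective.π (R.q.obj Q))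
  let b₂ := (R.adjI.homEquiv _ _).symm (Projective.π (R.e.obj Q))
  have : Epi (biprod.desc b₁ b₂) := R.epi_desc _ _
  let s := Projective.factorThru (𝟙 Q) (biprod.desc b₁ b₂)
  have hs : s ≫ biprod.desc b₁ b₂ = 𝟙 Q := Projective.factorThru_comp _ _
  have h : R.q.map (s ≫ biprod.fst) ≫ R.q.map b₁ = 𝟙 _ := by
    have h₂ : R.q.map (s ≫ biprod.snd) = 0 := (R.isZero_q_i _).eq_of_tgt _ _
    rw [biprod.desc_eq, Preadditive.comp_add, ← Category.assoc, ← Category.assoc] at hs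
    have := congr_arg R.q.map hs
    rwa [Functor.map_add, Functor.map_comp, Functor.map_comp _ (s ≫ biprod.snd), h₂, zero_comp,
      add_zero, R.q.map_id] at this
  have : Mono (R.t.map (R.q.map (s ≫ biprod.fst))) := by
    have : Mono (R.t.map (R.q.map (s ≫ biprod.fst)) ≫ R.t.map (R.q.map b₁)) := by
      rw [← Functor.map_comp, h, R.t.map_id]; infer_instance
    exact mono_of_mono _ (R.t.map (R.q.map b₁))
  have : Mono (R.adjT.counit.app Q ≫ s ≫ biprod.fst) := by
    have e : R.t.map (R.q.map (s ≫ biprod.fst)) ≫ R.adjT.counit.app _ =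
        R.adjT.counit.app Q ≫ s ≫ biprod.fst := R.adjT.counit_naturality _
    have := R.isIso_counit_t (Projective.over (R.q.obj Q))
    rw [← e]
    exact mono_comp _ _
  exact mono_of_mono _ (s ≫ biprod.fst)

lemma isIso_counit_of_isZero {N : C} (h : IsZero (R.q.obj N)) : IsIso (R.adjI.counit.app N) :=
  (R.isSES N).shortExact.isIso_f_iff.2 (R.j.map_isZero h)

/-- If `t (q N) ⟶ N` is a monomorphism, its cokernel comes from `A`. -/
lemma exists_cokernel (N : C) [Mono (R.adjT.counit.app N)] :
    ∃ (X : A) (η : N ⟶ R.i.obj X), IsSES (R.adjT.counit.app N) η := by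
  obtain ⟨D, p, h⟩ : ∃ (D : C) (p : N ⟶ D), IsSES (R.adjT.counit.app N) p :=
    ⟨_, _, IsSES.of_mono _⟩
  have hq : IsZero (R.q.obj D) := by
    refine (R.isSES_q h).shortExact.isIso_f_iff.1 ?_
    -- By the triangle identity this is inverse to a component of the unit of `t ⊣ q`.
    exact IsIso.of_isIso_fac_left (R.adjT.right_triangle_components N)
  have := R.isIso_counit_of_isZero hq
  exact ⟨R.e.obj D, p ≫ inv (R.adjI.counit.app D),
    h.of_iso (Iso.refl _) (Iso.refl _) (asIso (R.adjI.counit.app D)).symm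
      ((Category.id_comp _).trans (Category.comp_id _).symm) (Category.id_comp _)⟩

section

variable {N : C} {X : A} {η : N ⟶ R.i.obj X} (h : IsSES (R.adjT.counit.app N) η)

include h

/-- The object `X` is the largest quotient of `N` that comes from `A`. -/
lemma exists_factor {T : A} (k : N ⟶ R.i.obj T) : ∃ m : X ⟶ T, η ≫ R.i.map m = k := by
  obtain ⟨l, hl⟩ := h.exists_desc k (R.hom_t_i _)
  exact ⟨R.i.preimage l, by simpa using hl⟩

lemma projective_of_isSES [Projective N] : Projective X := by
  refine ⟨fun {T T'} f p hp => ?_⟩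
  have := h.epi
  obtain ⟨m, hm⟩ := R.exists_factor h (Projective.factorThru (η ≫ R.i.map f) (R.i.map p))
  refine ⟨m, R.i.map_injective ?_⟩
  rw [← cancel_epi η, Functor.map_comp, reassoc_of% hm, Projective.factorThru_comp]

end

lemma isSES_of_map_i {X Y Z : A} {f : X ⟶ Y} {g : Y ⟶ Z} (h : IsSES (R.i.map f) (R.i.map g)) :
    IsSES f g :=
  (R.isSES_e h).of_iso (asIso (R.adjI.unit.app X)).symm (asIso (R.adjI.unit.app Y)).symm
    (asIso (R.adjI.unit.app Z)).symm (by simp) (by simp)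

/-- The functor `t` is right exact, so a short exact sequence whose first map it keeps monic stays
short exact. -/
lemma isSES_t {X Y Z : B} {f : X ⟶ Y} {g : Y ⟶ Z} (h : IsSES f g) (hm : Mono (R.t.map f)) :
    IsSES (R.t.map f) (R.t.map g) := by
  have := h.epi
  refine IsSES.mk_of_desc (by rw [← Functor.map_comp, h.w, Functor.map_zero]) fun k hk => ?_
  obtain ⟨l, hl⟩ := h.exists_desc (R.adjT.homEquiv _ _ k) (by
    rw [← R.adjT.homEquiv_naturality_left, hk, Adjunction.homEquiv_unit, Functor.map_zero,
      comp_zero])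
  exact ⟨(R.adjT.homEquiv _ _).symm l, by
    rw [← R.adjT.homEquiv_naturality_left_symm, hl, Equiv.symm_apply_apply]⟩

/-! ### Gorenstein projective objects of a gluing -/

section Gorenstein

/-- The finiteness conditions on a gluing under which its Gorenstein projective objects are
described by those of its parts. For modules over the triangular matrix ring, the first condition
follows from the finite projective dimension of `M` as a left module, and the second one, which is
the vanishing of `Tor₁(M, Z)` for Gorenstein projective `Z`, from the finite flat dimension of `M`
as a right module. -/
structure IsCompatible : Prop where
  e_projective : ∀ Q : C, Projective Q → ∃ n : ℕ, HasProjectiveDimensionLE (R.e.obj Q) n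
  t_mono : ∀ {X Y Z : B} {f : X ⟶ Y} {g : Y ⟶ Z}, IsSES f g → gorensteinProjective B Z →
    Mono (R.t.map f)

variable [EnoughProjectives A]

lemma hasProjectiveDimensionLE_i (X : A) (n : ℕ) (hX : HasProjectiveDimensionLE X n) :
    HasProjectiveDimensionLE (R.i.obj X) n := by
  induction n generalizing X with
  | zero =>
    have := projective_iff_hasProjectiveDimensionLE_zero X |>.2 hX
    exact (projective_iff_hasProjectiveDimensionLE_zero _).1 inferInstance
  | succ n ih =>
    have h := IsSES.of_epi (Projective.π X)
    have h' := R.isSES_i h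
    exact (h'.shortExact.hasProjectiveDimensionLT_X₃_iff n
      (inferInstance : Projective (R.i.obj (Projective.over X)))).2
      (ih _ ((h.shortExact.hasProjectiveDimensionLT_X₃_iff n inferInstance).1 hX))

variable [HasExt.{w} C] [HasExt.{w} A]

variable {R} in
lemma ext_one_i_iff (X : A) (N : C) :
    Subsingleton (Ext.{w} (R.i.obj X) N 1) ↔ Subsingleton (Ext.{w} X (R.e.obj N) 1) :=
  have h := IsSES.of_epi (Projective.π X)
  Adjunction.ext_one_iff R.adjI h (R.isSES_i h) N

variable {R} (hR : R.IsCompatible)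

include hR

/-- The functor `i` preserves Gorenstein projective objects: `Ext¹(i X, Q)` is `Ext¹(X, e Q)`, and
for projective `Q` the object `e Q` has finite projective dimension. -/
lemma gorensteinProjective_i {X : A} (hX : gorensteinProjective A X) :
    gorensteinProjective C (R.i.obj X) := by
  have hG := isGorensteinClass_gorensteinProjective.{u, v, w} A
  have key : IsGorensteinClass.{u, v, w} (C := C) fun N =>
      ∃ X, gorensteinProjective A X ∧ N = R.i.obj X := by
    refine ⟨?_, ?_, ?_⟩
    · rintro _ ⟨X, hX, rfl⟩ Q hQ
      obtain ⟨X', P, f, g, hP, hX', h⟩ := hG.prev X hX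
      obtain ⟨n, hn⟩ := hR.e_projective Q hQ
      exact (Adjunction.ext_one_iff R.adjI h (R.isSES_i h) Q).2
        (ext_gorensteinProjective_of_hasProjectiveDimensionLE hX n hn 0)
    · rintro _ ⟨X, hX, rfl⟩
      obtain ⟨P, X', f, g, hP, hX', h⟩ := hG.next X hX
      exact ⟨_, _, _, _, inferInstance, ⟨X', hX', rfl⟩, R.isSES_i h⟩
    · rintro _ ⟨X, hX, rfl⟩
      obtain ⟨X', P, f, g, hP, hX', h⟩ := hG.prev X hX
      exact ⟨_, _, _, _, inferInstance, ⟨X', hX', rfl⟩, R.isSES_i h⟩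
  exact key.le _ ⟨X, hX, rfl⟩

variable [HasExt.{w} B]

omit [EnoughProjectives A] [HasExt.{w} A] in
lemma ext_one_t_iff {Y : B} (hY : gorensteinProjective B Y) (N : C) :
    Subsingleton (Ext.{w} (R.t.obj Y) N 1) ↔ Subsingleton (Ext.{w} Y (R.q.obj N) 1) := by
  obtain ⟨Y', P, f, g, hP, hY', h⟩ :=
    (isGorensteinClass_gorensteinProjective.{u, v, w} B).prev Y hY
  exact Adjunction.ext_one_iff R.adjT h (R.isSES_t h (hR.t_mono h hY)) N

omit [EnoughProjectives A] [HasExt.{w} A] in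
lemma gorensteinProjective_t {Y : B} (hY : gorensteinProjective B Y) :
    gorensteinProjective C (R.t.obj Y) := by
  have hG := isGorensteinClass_gorensteinProjective.{u, v, w} B
  have key : IsGorensteinClass.{u, v, w} (C := C) fun N =>
      ∃ Y, gorensteinProjective B Y ∧ N = R.t.obj Y := by
    refine ⟨?_, ?_, ?_⟩
    · rintro _ ⟨Y, hY, rfl⟩ Q hQ
      exact (ext_one_t_iff hR hY Q).2 (hG.ext_one Y hY _ inferInstance)
    · rintro _ ⟨Y, hY, rfl⟩
      obtain ⟨P, Y', f, g, hP, hY', h⟩ := hG.next Y hY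
      exact ⟨_, _, _, _, inferInstance, ⟨Y', hY', rfl⟩, R.isSES_t h (hR.t_mono h hY')⟩
    · rintro _ ⟨Y, hY, rfl⟩
      obtain ⟨Y', P, f, g, hP, hY', h⟩ := hG.prev Y hY
      exact ⟨_, _, _, _, inferInstance, ⟨Y', hY', rfl⟩, R.isSES_t h (hR.t_mono h hY)⟩
  exact key.le _ ⟨Y, hY, rfl⟩

variable [EnoughProjectives B] [EnoughProjectives C]

omit [HasExt.{w} A] [HasExt.{w} B] [EnoughProjectives B] in
/-- Gorenstein projective objects have no extensions by `j T` for projective `T`, because `t T` is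
a projective object mapping onto `j T` with kernel of finite projective dimension. -/
lemma ext_j_projective {N : C} (hN : gorensteinProjective C N) (T : B) [Projective T] :
    Subsingleton (Ext.{w} N (R.j.obj T) 1) := by
  obtain ⟨n, hn⟩ := hR.e_projective (R.t.obj T) inferInstance
  have := ext_gorensteinProjective_of_hasProjectiveDimensionLE.{u, v, w} hN n
    (R.hasProjectiveDimensionLE_i _ n hn) 1
  have := ext_gorensteinProjective_projective.{u, v, w} hN (Q := R.t.obj T) 0
  have : Subsingleton (Ext.{w} N (R.j.obj (R.q.obj (R.t.obj T))) 1) :=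
    IsSES.ext_last_right (n := 1) (R.isSES (R.t.obj T))
  exact ext_subsingleton_of_iso (Iso.refl N) (N := R.j.obj (R.q.obj (R.t.obj T)))
    (R.j.mapIso (asIso (R.adjT.unit.app T)).symm)

omit [HasExt.{w} A] [EnoughProjectives B] in
/-- The functor `q` preserves Gorenstein projective objects, since `Ext¹(q N, T)` is
`Ext¹(N, j T)`. -/
lemma gorensteinProjective_q {N : C} (hN : gorensteinProjective C N) :
    gorensteinProjective B (R.q.obj N) := by
  have hG := isGorensteinClass_gorensteinProjective.{u, v, w} C
  have key : IsGorensteinClass.{u, v, w} (C := B) fun Y =>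
      ∃ N, gorensteinProjective C N ∧ Y = R.q.obj N := by
    refine ⟨?_, ?_, ?_⟩
    · rintro _ ⟨N, hN, rfl⟩ T hT
      obtain ⟨N', P, f, g, hP, hN', h⟩ := hG.prev N hN
      exact (Adjunction.ext_one_iff R.adjJ h (R.isSES_q h) T).2 (ext_j_projective hR hN T)
    · rintro _ ⟨N, hN, rfl⟩
      obtain ⟨P, N', f, g, hP, hN', h⟩ := hG.next N hN
      exact ⟨_, _, _, _, inferInstance, ⟨N', hN', rfl⟩, R.isSES_q h⟩
    · rintro _ ⟨N, hN, rfl⟩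
      obtain ⟨N', P, f, g, hP, hN', h⟩ := hG.prev N hN
      exact ⟨_, _, _, _, inferInstance, ⟨N', hN', rfl⟩, R.isSES_q h⟩
  exact key.le _ ⟨N, hN, rfl⟩

omit [HasExt.{w} A] in
/-- For a Gorenstein projective object `N`, the morphism `t (q N) ⟶ N` is a monomorphism. Embed `N`
in a projective object `P` with Gorenstein projective cokernel; then `t (q N) ⟶ t (q P) ⟶ P` is a
composite of monomorphisms. -/
lemma mono_counit_of_gorensteinProjective {N : C} (hN : gorensteinProjective C N) :
    Mono (R.adjT.counit.app N) := by
  obtain ⟨P, N', f, g, hP, hN', h⟩ :=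
    (isGorensteinClass_gorensteinProjective.{u, v, w} C).next N hN
  have := hR.t_mono (R.isSES_q h) (gorensteinProjective_q hR hN')
  have := R.mono_counit_of_projective P
  have e : R.t.map (R.q.map f) ≫ R.adjT.counit.app P = R.adjT.counit.app N ≫ f :=
    R.adjT.counit_naturality f
  have : Mono (R.adjT.counit.app N ≫ f) := by
    rw [← e]
    exact mono_comp _ _
  exact mono_of_mono _ f

omit [HasExt.{w} A] [EnoughProjectives B] in
/-- The cokernels of `t (q -) ⟶ -` form a short exact sequence. -/
lemma exists_isSES_cokernel {N N' P : C} {f : N' ⟶ P} {g : P ⟶ N} (h : IsSES f g)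
    (hN : gorensteinProjective C N) {X X' X'' : A} {η : N ⟶ R.i.obj X} {η' : N' ⟶ R.i.obj X'}
    {η'' : P ⟶ R.i.obj X''} (hη : IsSES (R.adjT.counit.app N) η)
    (hη' : IsSES (R.adjT.counit.app N') η') (hη'' : IsSES (R.adjT.counit.app P) η'') :
    ∃ (f' : X' ⟶ X'') (g' : X'' ⟶ X), IsSES f' g' ∧ f ≫ η'' = η' ≫ R.i.map f' := by
  have hq := R.isSES_q h
  have ht := R.isSES_t hq (hR.t_mono hq (gorensteinProjective_q hR hN))
  obtain ⟨f', g', h', e, -⟩ := IsSES.nine ht h hη' hη'' hη (R.adjT.counit_naturality f)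
    (R.adjT.counit_naturality g)
  refine ⟨R.i.preimage f', R.i.preimage g', R.isSES_of_map_i (by simpa using h'), by simpa using e⟩

/-- The cokernel of `t (q N) ⟶ N` is Gorenstein projective if `N` is. -/
lemma gorensteinProjective_of_isSES {N : C} (hN : gorensteinProjective C N) {X : A}
    {η : N ⟶ R.i.obj X} (hη : IsSES (R.adjT.counit.app N) η) : gorensteinProjective A X := by
  have hG := isGorensteinClass_gorensteinProjective.{u, v, w} C
  have key : IsGorensteinClass.{u, v, w} (C := A) fun X => ∃ N, gorensteinProjective C N ∧
      ∃ η : N ⟶ R.i.obj X, IsSES (R.adjT.counit.app N) η := by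
    refine ⟨?_, ?_, ?_⟩
    · rintro X ⟨N, hN, η, hη⟩ T hT
      obtain ⟨N', P, f, g, hP, hN', h⟩ := hG.prev N hN
      have := mono_counit_of_gorensteinProjective hR hN'
      have := R.mono_counit_of_projective P
      obtain ⟨X', η', hη'⟩ := R.exists_cokernel N'
      obtain ⟨X'', η'', hη''⟩ := R.exists_cokernel P
      obtain ⟨f', g', h', e⟩ := exists_isSES_cokernel hR h hN hη hη' hη''
      have := R.projective_of_isSES hη''
      refine h'.ext_one_of_extension fun k => ?_
      have := hG.ext_one N hN (R.i.obj T) inferInstance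
      obtain ⟨l, hl⟩ := h.exists_extension (η' ≫ R.i.map k)
      obtain ⟨m, rfl⟩ := R.exists_factor hη'' l
      have := hη'.epi
      refine ⟨m, R.i.map_injective ?_⟩
      rw [← cancel_epi η', ← hl, reassoc_of% e, Functor.map_comp]
    · rintro X ⟨N, hN, η, hη⟩
      obtain ⟨P, N', f, g, hP, hN', h⟩ := hG.next N hN
      have := mono_counit_of_gorensteinProjective hR hN'
      have := R.mono_counit_of_projective P
      obtain ⟨X', η', hη'⟩ := R.exists_cokernel N'
      obtain ⟨X'', η'', hη''⟩ := R.exists_cokernel P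
      obtain ⟨f', g', h', e⟩ := exists_isSES_cokernel hR h hN' hη' hη hη''
      exact ⟨_, _, f', g', R.projective_of_isSES hη'', ⟨N', hN', η', hη'⟩, h'⟩
    · rintro X ⟨N, hN, η, hη⟩
      obtain ⟨N', P, f, g, hP, hN', h⟩ := hG.prev N hN
      have := mono_counit_of_gorensteinProjective hR hN'
      have := R.mono_counit_of_projective P
      obtain ⟨X', η', hη'⟩ := R.exists_cokernel N'
      obtain ⟨X'', η'', hη''⟩ := R.exists_cokernel P
      obtain ⟨f', g', h', e⟩ := exists_isSES_cokernel hR h hN hη hη' hη''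
      exact ⟨_, _, f', g', R.projective_of_isSES hη'', ⟨N', hN', η', hη'⟩, h'⟩
  exact key.le _ ⟨N, hN, η, hη⟩

/-- The orthogonal class of the Gorenstein projective objects is detected on the two parts, since a
Gorenstein projective `W` is an extension of an object `i X` by `t (q W)`, with `X` and `q W`
Gorenstein projective. -/
lemma orthogonal_of_parts {N : C}
    (he : extOneRightOrthogonal.{u, v, w} (gorensteinProjective A) (R.e.obj N))
    (hq : extOneRightOrthogonal.{u, v, w} (gorensteinProjective B) (R.q.obj N)) :
    extOneRightOrthogonal.{u, v, w} (gorensteinProjective C) N := by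
  intro W hW
  have := mono_counit_of_gorensteinProjective hR hW
  obtain ⟨X, η, hη⟩ := R.exists_cokernel W
  have hX := gorensteinProjective_of_isSES hR hW hη
  have hY := gorensteinProjective_q hR hW
  have : Subsingleton (Ext.{w} (R.t.obj (R.q.obj W)) N 1) := (ext_one_t_iff hR hY N).2 (hq _ hY)
  have := (ext_one_i_iff X N).2 (he _ hX)
  exact IsSES.ext_middle_left (X := R.t.obj (R.q.obj W)) (Y := W) hη

omit [HasExt.{w} B] [EnoughProjectives B] [EnoughProjectives C] in
lemma orthogonal_e {N : C} (hN : extOneRightOrthogonal.{u, v, w} (gorensteinProjective C) N) :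
    extOneRightOrthogonal.{u, v, w} (gorensteinProjective A) (R.e.obj N) :=
  fun X hX => (ext_one_i_iff X N).1 (hN _ (gorensteinProjective_i hR hX))

omit [EnoughProjectives A] [HasExt.{w} A] [EnoughProjectives B] [EnoughProjectives C] in
lemma orthogonal_q {N : C} (hN : extOneRightOrthogonal.{u, v, w} (gorensteinProjective C) N) :
    extOneRightOrthogonal.{u, v, w} (gorensteinProjective B) (R.q.obj N) :=
  fun _ hY => (ext_one_t_iff hR hY N).1 (hN _ (gorensteinProjective_t hR hY))

omit [HasExt.{w} A] [EnoughProjectives B] in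
/-- The part in `B` of a special precover of `j Y` is a special precover of `Y`. -/
theorem isSpecialPrecovering_right
    (h : IsSpecialPrecovering.{u, v, w} (gorensteinProjective C)) :
    IsSpecialPrecovering.{u, v, w} (gorensteinProjective B) := by
  intro Y
  obtain ⟨W, f, hf, hW, hK⟩ := h (R.j.obj Y)
  have hs := R.isSES_q (IsSES.of_epi f)
  have := hs.epi
  refine ⟨R.q.obj W, R.q.map f ≫ R.adjJ.counit.app Y, epi_comp _ _,
    gorensteinProjective_q hR hW, ?_⟩
  have hs' : IsSES (R.q.map (kernel.ι f)) (R.q.map f ≫ R.adjJ.counit.app Y) :=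
    hs.of_iso (Iso.refl _) (Iso.refl _) (asIso (R.adjJ.counit.app Y)) (by simp) (by simp)
  obtain ⟨e⟩ := hs'.exists_iso_left (@IsSES.of_epi _ _ _ _ _ _ hs'.epi)
  exact extOneRightOrthogonal_of_iso e (orthogonal_q hR hK)

/-- A special precover `W ⟶ i X` factors through the cokernel `i G` of `t (q W) ⟶ W`, and `G ⟶ X` is
a special precover. Its kernel differs from the part in `A` of the kernel of `W ⟶ i X` by the part
of `t (q W)`, which has finite projective dimension because `q W` is projective. -/
theorem isSpecialPrecovering_left
    (h : IsSpecialPrecovering.{u, v, w} (gorensteinProjective C)) :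
    IsSpecialPrecovering.{u, v, w} (gorensteinProjective A) := by
  intro X
  obtain ⟨W, f, hf, hW, hK⟩ := h (R.i.obj X)
  have := mono_counit_of_gorensteinProjective hR hW
  obtain ⟨G, η, hη⟩ := R.exists_cokernel W
  obtain ⟨p, rfl⟩ := R.exists_factor hη f
  have := hη.epi
  have : Epi (R.i.map p) := epi_of_epi η _
  have hp : Epi p := R.i.epi_of_epi_map this
  refine ⟨G, p, hp, gorensteinProjective_of_isSES hR hW hη, ?_⟩
  -- The kernel of the precover of `i X` is an extension of `i (ker p)` by `t (q W)`.
  have hp := R.isSES_i (IsSES.of_epi p)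
  have sq := IsPullback.of_hasPullback (R.i.map (kernel.ι p)) η
  obtain ⟨k, hk, -⟩ := hη.of_isPullback sq.flip
  have := hp.mono
  have hK' : IsSES (pullback.snd (R.i.map (kernel.ι p)) η) (η ≫ R.i.map p) := by
    refine IsSES.mk_of_lift (by rw [← sq.w_assoc, hp.w, comp_zero]) fun y hy => ?_
    obtain ⟨z, hz⟩ := hp.exists_lift (y ≫ η) (by rw [Category.assoc, hy])
    exact ⟨sq.lift z y hz, by simp⟩
  obtain ⟨a⟩ := (IsSES.of_epi (η ≫ R.i.map p)).exists_iso_left hK'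
  -- `q W` lies in the orthogonal class because `q` kills `i X`; being Gorenstein projective, it is
  -- projective.
  have hq : extOneRightOrthogonal.{u, v, w} (gorensteinProjective B) (R.q.obj W) := by
    intro Y hY
    have := orthogonal_q hR hK Y hY
    have := ext_subsingleton_of_isZero.{u, v, w} Y (R.isZero_q_i X) 1
    exact (R.isSES_q (IsSES.of_epi (η ≫ R.i.map p))).ext_middle_right
  have := projective_of_gorensteinProjective_of_orthogonal (gorensteinProjective_q hR hW) hq
  obtain ⟨n, hn⟩ := hR.e_projective (R.t.obj (R.q.obj W)) inferInstance
  intro Z hZ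
  have := ext_gorensteinProjective_of_hasProjectiveDimensionLE.{u, v, w} hZ n hn 1
  have := orthogonal_e hR (extOneRightOrthogonal_of_iso a hK) Z hZ
  have : Subsingleton (Ext.{w} Z (R.e.obj (R.i.obj (kernel p))) 1) :=
    IsSES.ext_last_right (X := R.e.obj (R.t.obj (R.q.obj W))) (n := 1) (R.isSES_e hk)
  exact ext_subsingleton_of_iso (N := R.e.obj (R.i.obj (kernel p))) (Iso.refl Z)
    (asIso (R.adjI.unit.app (kernel p))).symm

/-- A precover `G ⟶ q N` and an epimorphism `P ⟶ e N` with `P` projective, for the parts of `N`,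
give an epimorphism `t G ⊞ i P ⟶ N` from a Gorenstein projective object. The part in `B` of its
kernel already lies in the orthogonal class. The part in `A` need not, and is replaced by a
preenvelope of it: pushing out along this preenvelope enlarges the kernel and changes the source by
an extension with a Gorenstein projective object. -/
theorem isSpecialPrecovering_of_parts [EnoughInjectives A]
    (hA : IsSpecialPrecovering.{u, v, w} (gorensteinProjective A))
    (hB : IsSpecialPrecovering.{u, v, w} (gorensteinProjective B)) :
    IsSpecialPrecovering.{u, v, w} (gorensteinProjective C) := by
  intro N
  obtain ⟨G, p, hp, hG, hK⟩ := hB (R.q.obj N)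
  have ha := R.epi_desc p (Projective.π (R.e.obj N))
  obtain ⟨a, haq, ha⟩ : ∃ a : R.t.obj G ⊞ R.i.obj (Projective.over (R.e.obj N)) ⟶ N,
      biprod.inl ≫ a = (R.adjT.homEquiv _ _).symm p ∧ Epi a := ⟨_, biprod.inl_desc _ _, ha⟩
  have hL := IsSES.of_epi a
  have hT : gorensteinProjective C (R.t.obj G ⊞ R.i.obj (Projective.over (R.e.obj N))) :=
    gorensteinProjective_extension.{u, v, w} (IsSES.biprod _ _) (gorensteinProjective_t hR hG)
      (gorensteinProjective_of_projective.{u, v, w} _)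
  -- `q` identifies the kernel of `a` with the kernel of `p`.
  have hqL : extOneRightOrthogonal.{u, v, w} (gorensteinProjective B) (R.q.obj (kernel a)) := by
    have hb := R.isSES_q (IsSES.biprod (R.t.obj G) (R.i.obj (Projective.over (R.e.obj N))))
    have := hb.shortExact.isIso_f_iff.2 (R.isZero_q_i _)
    have : IsIso (R.q.map
      (biprod.inl : R.t.obj G ⟶ R.t.obj G ⊞ R.i.obj (Projective.over (R.e.obj N)))) := this
    let b := asIso (R.adjT.unit.app G) ≪≫ asIso (R.q.map
      (biprod.inl : R.t.obj G ⟶ R.t.obj G ⊞ R.i.obj (Projective.over (R.e.obj N))))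
    have hb : b.hom ≫ R.q.map a = p := by
      change (R.adjT.unit.app G ≫ R.q.map biprod.inl) ≫ R.q.map a = p
      rw [Category.assoc, ← R.q.map_comp, haq]
      exact (R.adjT.homEquiv_unit ..).symm.trans (Equiv.apply_symm_apply _ _)
    obtain ⟨c⟩ := ((R.isSES_q hL).of_iso (Iso.refl _) b.symm (Iso.refl _) (f' := R.q.map
      (kernel.ι a) ≫ b.inv) (g' := p) (by simp) (by simp [← hb])).exists_iso_left (IsSES.of_epi p)
    exact extOneRightOrthogonal_of_iso c.symm hK
  -- Embed the kernel of `a` in an object of the orthogonal class, changing only its part in `A`.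
  obtain ⟨E₀, C₀, f₀, g₀, hfg, hC₀, hE₀⟩ := hA.exists_preenvelope (R.e.obj (kernel a))
  have sq := IsPushout.of_hasPushout (R.adjI.counit.app (kernel a)) (R.i.map f₀)
  obtain ⟨r, hr, -⟩ := (R.isSES (kernel a)).of_isPushout sq
  obtain ⟨s, hs, -⟩ := (R.isSES_i hfg).of_isPushout sq.flip
  have hE : extOneRightOrthogonal.{u, v, w} (gorensteinProjective C)
      (pushout (R.adjI.counit.app (kernel a)) (R.i.map f₀)) := by
    refine orthogonal_of_parts hR (fun X hX => ?_) fun Y hY => ?_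
    · have := ext_subsingleton_of_isZero.{u, v, w} X (R.isZero_e_j (R.q.obj (kernel a))) 1
      have := extOneRightOrthogonal_of_iso (N' := R.e.obj (R.i.obj E₀))
        (asIso (R.adjI.unit.app E₀)) hE₀ X hX
      exact (R.isSES_e hr).ext_middle_right
    · have := ext_subsingleton_of_isZero.{u, v, w} Y (R.isZero_q_i E₀) 1
      have := extOneRightOrthogonal_of_iso (N' := R.q.obj (R.j.obj (R.q.obj (kernel a))))
        (asIso (R.adjJ.counit.app _)).symm hqL Y hY
      exact (R.isSES_q hr).ext_middle_right
  -- Pushing out `a` along this embedding of its kernel gives the precover.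
  have sq' := IsPushout.of_hasPushout (kernel.ι a)
    (pushout.inl (R.adjI.counit.app (kernel a)) (R.i.map f₀))
  obtain ⟨x, hx, -⟩ := hL.of_isPushout sq'
  obtain ⟨y, hy, -⟩ := hs.of_isPushout sq'.flip
  obtain ⟨c⟩ := hx.exists_iso_left (@IsSES.of_epi _ _ _ _ _ _ hx.epi)
  exact ⟨_, x, hx.epi, gorensteinProjective_extension.{u, v, w} hy hT
    (gorensteinProjective_i hR hC₀), extOneRightOrthogonal_of_iso c hE⟩

theorem isSpecialPrecovering_iff [EnoughInjectives A] :
    IsSpecialPrecovering.{u, v, w} (gorensteinProjective C) ↔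
      IsSpecialPrecovering.{u, v, w} (gorensteinProjective A) ∧
        IsSpecialPrecovering.{u, v, w} (gorensteinProjective B) :=
  ⟨fun h => ⟨isSpecialPrecovering_left hR h, isSpecialPrecovering_right hR h⟩,
    fun h => isSpecialPrecovering_of_parts hR h.1 h.2⟩

end Gorenstein

end TriangularGluing

end Gluing

/-! ### Short exact sequences of modules and direct sums of copies -/

section Modules

variable {A : Type u} [Ring A]

lemma ModuleCat.isSES_iff {X Y Z : ModuleCat.{u} A} {f : X ⟶ Y} {g : Y ⟶ Z} :
    IsSES f g ↔ Function.Injective f ∧ Function.Surjective g ∧ Function.Exact f g := by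
  constructor
  · intro h
    exact ⟨h.shortExact.moduleCat_injective_f, h.shortExact.moduleCat_surjective_g,
      (ShortComplex.ShortExact.moduleCat_exact_iff_function_exact _).1 h.shortExact.exact⟩
  · rintro ⟨hf, hg, h⟩
    have w : f ≫ g = 0 := by
      ext x
      exact h.apply_apply_eq_zero x
    exact ⟨w, .mk' ((ShortComplex.ShortExact.moduleCat_exact_iff_function_exact _).2 h)
      ((ModuleCat.mono_iff_injective f).2 hf) ((ModuleCat.epi_iff_surjective g).2 hg)⟩

lemma ModuleCat.isSES_restrictScalars {B : Type u} [Ring B] (φ : A →+* B) {X Y Z : ModuleCat.{u} B}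
    {f : X ⟶ Y} {g : Y ⟶ Z} (h : IsSES f g) :
    IsSES ((restrictScalars φ).map f) ((restrictScalars φ).map g) :=
  have h := ModuleCat.isSES_iff.1 h
  ModuleCat.isSES_iff.2 ⟨h.1, h.2.1, h.2.2⟩

lemma ModuleCat.isSES_finsupp (I : Type u) {X Y Z : ModuleCat.{u} A} {f : X ⟶ Y} {g : Y ⟶ Z}
    (h : IsSES f g) : IsSES (ModuleCat.ofHom (Finsupp.mapRange.linearMap (α := I) f.hom))
      (ModuleCat.ofHom (Finsupp.mapRange.linearMap (α := I) g.hom)) := by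
  obtain ⟨hf, hg, h⟩ := ModuleCat.isSES_iff.1 h
  refine ModuleCat.isSES_iff.2 ⟨Finsupp.mapRange_injective _ (map_zero _) hf,
    Finsupp.mapRange_surjective _ (map_zero _) hg, fun y => ⟨fun hy => ?_, ?_⟩⟩
  · have hy' : ∀ i, ∃ x, f x = y i := fun i => (h _).1 (DFunLike.congr_fun hy i)
    choose x hx using hy'
    refine ⟨Finsupp.ofSupportFinite x (y.hasFiniteSupport.subset fun i hi hi' => hi (hf ?_)), ?_⟩
    · rw [hx, hi', map_zero]
    · ext i
      exact hx i
  · rintro ⟨x, rfl⟩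
    ext i
    exact h.apply_apply_eq_zero (x i)

lemma ModuleCat.projective_finsupp (I : Type u) (X : ModuleCat.{u} A) (hX : Projective X) :
    Projective (ModuleCat.of A (I →₀ X)) := by
  classical
  have : Module.Projective A X := (IsProjective.iff_projective (R := A) X).2 hX
  exact (IsProjective.iff_projective (R := A) (I →₀ X)).1
    (Module.Projective.of_equiv (finsuppLequivDFinsupp (ι := I) (M := X) A).symm)

lemma ModuleCat.hasProjectiveDimensionLE_finsupp (I : Type u) (n : ℕ) (X : ModuleCat.{u} A)
    (hX : HasProjectiveDimensionLE X n) :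
    HasProjectiveDimensionLE (ModuleCat.of A (I →₀ X)) n := by
  induction n generalizing X with
  | zero =>
    have := (projective_iff_hasProjectiveDimensionLE_zero X).2 hX
    exact (projective_iff_hasProjectiveDimensionLE_zero _).1 (ModuleCat.projective_finsupp I X this)
  | succ n ih =>
    have h := IsSES.of_epi (Projective.π X)
    exact ((ModuleCat.isSES_finsupp I h).shortExact.hasProjectiveDimensionLT_X₃_iff n
      (ModuleCat.projective_finsupp I _ inferInstance)).2
      (ih _ ((h.shortExact.hasProjectiveDimensionLT_X₃_iff n inferInstance).1 hX))

end Modules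

/-! ### Corners of modules and induction -/

section Corner

variable {A Λ : Type u} [Ring A] [Ring Λ] (ρ : A →ₙ+* Λ)

/-- For a multiplicative and additive map `ρ : A → Λ` that need not preserve the unit, the part
`ρ 1 • N` of a `Λ`-module `N`. It is written as the set of elements fixed by the idempotent
`ρ 1`. -/
def cornerSubgroup (N : Type u) [AddCommGroup N] [Module Λ N] : AddSubgroup N where
  carrier := {n | ρ 1 • n = n}
  add_mem' {x y} hx hy := by
    change ρ 1 • (x + y) = x + y
    rw [smul_add, hx, hy]
  zero_mem' := smul_zero _
  neg_mem' {x} hx := by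
    change ρ 1 • (-x) = -x
    rw [smul_neg, hx]

/-- The corner `ρ 1 • N` as a type. -/
def Corner (N : Type u) [AddCommGroup N] [Module Λ N] : Type u := cornerSubgroup ρ N

namespace Corner

variable {N : Type u} [AddCommGroup N] [Module Λ N]

instance : AddCommGroup (Corner ρ N) := inferInstanceAs (AddCommGroup (cornerSubgroup ρ N))

variable {ρ}

/-- The underlying element of `N`. -/
def val (x : Corner ρ N) : N := Subtype.val x

lemma smul_val (x : Corner ρ N) : ρ 1 • x.val = x.val := x.2

/-- An element of the corner from an element of `N` fixed by `ρ 1`. -/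
def mk (n : N) (h : ρ 1 • n = n) : Corner ρ N := ⟨n, h⟩

@[simp] lemma val_mk (n : N) (h : ρ 1 • n = n) : (mk n h).val = n := rfl
@[simp] lemma val_add (x y : Corner ρ N) : (x + y).val = x.val + y.val := rfl

@[ext] lemma ext {x y : Corner ρ N} (h : x.val = y.val) : x = y := Subtype.ext h

lemma map_one_mul (a : A) : ρ 1 * ρ a = ρ a := by rw [← map_mul, one_mul]

lemma map_mul_one (a : A) : ρ a * ρ 1 = ρ a := by rw [← map_mul, mul_one]

instance : Module A (Corner ρ N) where
  smul a x := mk (ρ a • x.val) (by rw [← mul_smul, map_one_mul])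
  one_smul x := ext x.smul_val
  mul_smul a b x := ext (by
    change ρ (a * b) • x.val = ρ a • ρ b • x.val
    rw [map_mul, mul_smul])
  smul_zero a := ext (smul_zero (ρ a))
  smul_add a x y := ext (smul_add (ρ a) x.val y.val)
  add_smul a b x := ext (by
    change ρ (a + b) • x.val = ρ a • x.val + ρ b • x.val
    rw [map_add, add_smul])
  zero_smul x := ext (by
    change ρ 0 • x.val = 0
    rw [map_zero, zero_smul])

@[simp] lemma val_smul (a : A) (x : Corner ρ N) : (a • x).val = ρ a • x.val := rfl

variable (ρ) in
/-- The projection `n ↦ ρ 1 • n` onto the corner. -/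
def proj (n : N) : Corner ρ N := mk (ρ 1 • n) (by rw [← mul_smul, map_one_mul])

end Corner

/-- The functor `N ↦ ρ 1 • N`. -/
def cornerFunctor : ModuleCat.{u} Λ ⥤ ModuleCat.{u} A where
  obj N := ModuleCat.of A (Corner ρ N)
  map {N N'} f := ModuleCat.ofHom
    { toFun := fun x => Corner.mk (f x.val) (by rw [← map_smul, x.smul_val])
      map_add' := fun x y => Corner.ext (map_add f.hom x.val y.val)
      map_smul' := fun a x => Corner.ext (map_smul f.hom (ρ a) x.val) }

instance : (cornerFunctor ρ).Additive where

lemma isSES_cornerFunctor {X Y Z : ModuleCat.{u} Λ} {f : X ⟶ Y} {g : Y ⟶ Z} (h : IsSES f g) :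
    IsSES ((cornerFunctor ρ).map f) ((cornerFunctor ρ).map g) := by
  obtain ⟨hf, hg, h⟩ := ModuleCat.isSES_iff.1 h
  refine ModuleCat.isSES_iff.2 ⟨fun (x y : Corner ρ X) hxy => Corner.ext (hf ?_),
    fun (z : Corner ρ Z) => ?_, fun (y : Corner ρ Y) => ⟨fun hy => ?_, ?_⟩⟩
  · exact congr_arg Corner.val hxy
  · obtain ⟨y, hy⟩ := hg z.val
    refine ⟨Corner.proj ρ y, Corner.ext ?_⟩
    change g (ρ 1 • y) = z.val
    rw [map_smul, hy, z.smul_val]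
  · obtain ⟨x, hx⟩ := (h y.val).1 (congr_arg Corner.val hy)
    refine ⟨Corner.mk x (hf ?_), Corner.ext hx⟩
    rw [map_smul, hx, y.smul_val]
  · rintro ⟨x, rfl⟩
    exact Corner.ext (h.apply_apply_eq_zero (Corner.val x))

/-- The relations defining the left adjoint of the corner functor: the module generated by symbols
`y ∈ Y` subject to additivity and to `s y = ρ s • y`. -/
noncomputable def inductionRelations (Y : Type u) [AddCommGroup Y] [Module A Y] :
    Submodule Λ (Y →₀ Λ) :=
  Submodule.span Λ
    ({r | ∃ y y' : Y, r = Finsupp.single (y + y') 1 - Finsupp.single y 1 - Finsupp.single y' 1} ∪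
      {r | ∃ (a : A) (y : Y), r = Finsupp.single (a • y) 1 - Finsupp.single y (ρ a)})

/-- The `Λ`-module induced from an `A`-module along `ρ`; this is `Λ (ρ 1) ⊗ Y`. -/
abbrev Induced (Y : Type u) [AddCommGroup Y] [Module A Y] : Type u :=
  (Y →₀ Λ) ⧸ inductionRelations ρ Y

namespace Induced

variable (Y : Type u) [AddCommGroup Y] [Module A Y]

/-- The generator of the induced module attached to an element of `Y`. -/
noncomputable def of (y : Y) : Induced ρ Y := Submodule.Quotient.mk (Finsupp.single y 1)

variable {ρ Y}

lemma of_add (y y' : Y) : of ρ Y (y + y') = of ρ Y y + of ρ Y y' := by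
  have : (Submodule.Quotient.mk (Finsupp.single (y + y') 1 - Finsupp.single y 1 -
      Finsupp.single y' 1) : Induced ρ Y) = 0 :=
    (Submodule.Quotient.mk_eq_zero _).2 (Submodule.subset_span (Or.inl ⟨y, y', rfl⟩))
  rw [sub_sub] at this
  exact sub_eq_zero.1 this

lemma of_smul (a : A) (y : Y) : of ρ Y (a • y) = ρ a • of ρ Y y := by
  have : (Submodule.Quotient.mk (Finsupp.single (a • y) 1 - Finsupp.single y (ρ a)) :
      Induced ρ Y) = 0 :=
    (Submodule.Quotient.mk_eq_zero _).2 (Submodule.subset_span (Or.inr ⟨a, y, rfl⟩))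
  rw [Submodule.Quotient.mk_sub] at this
  refine (sub_eq_zero.1 this).trans ?_
  rw [of, ← Submodule.Quotient.mk_smul, Finsupp.smul_single, smul_eq_mul, mul_one]

variable (ρ) in
/-- The universal property of the induced module. -/
noncomputable def homEquiv (Y : ModuleCat.{u} A) (N : ModuleCat.{u} Λ) :
    (ModuleCat.of Λ (Induced ρ Y) ⟶ N) ≃ (Y ⟶ (cornerFunctor ρ).obj N) where
  toFun f := ModuleCat.ofHom
    { toFun := fun y => Corner.mk (ρ := ρ) (f (of ρ Y y)) (by
        rw [← map_smul, ← of_smul, one_smul])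
      map_add' := fun y y' => Corner.ext (by
        change f (of ρ Y (y + y')) = f (of ρ Y y) + f (of ρ Y y')
        rw [of_add, map_add])
      map_smul' := fun a y => Corner.ext (by
        change f (of ρ Y (a • y)) = ρ a • f (of ρ Y y)
        rw [of_smul, map_smul]) }
  invFun g := ModuleCat.ofHom (Submodule.liftQ _
    (Finsupp.linearCombination Λ fun y => Corner.val (ρ := ρ) (g y)) (by
      rw [inductionRelations, Submodule.span_le]
      rintro _ (⟨y, y', rfl⟩ | ⟨a, y, rfl⟩)
      · simp only [SetLike.mem_coe, LinearMap.mem_ker, map_sub,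
          Finsupp.linearCombination_single, one_smul, sub_sub, sub_eq_zero, map_add]
        exact Corner.val_add _ _
      · simp only [SetLike.mem_coe, LinearMap.mem_ker, map_sub,
          Finsupp.linearCombination_single, one_smul, sub_eq_zero, map_smul]
        exact Corner.val_smul _ _))
  left_inv f := by
    refine ModuleCat.hom_ext (Submodule.linearMap_qext _ (Finsupp.lhom_ext' fun y =>
      LinearMap.ext_ring ?_))
    change Finsupp.linearCombination Λ _ (Finsupp.single y 1) = f (of ρ Y y)
    rw [Finsupp.linearCombination_single, one_smul]
    rfl
  right_inv g := by
    refine ModuleCat.hom_ext (LinearMap.ext fun y => Corner.ext ?_)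
    change Finsupp.linearCombination Λ _ (Finsupp.single y 1) = Corner.val (ρ := ρ) (g y)
    rw [Finsupp.linearCombination_single, one_smul]

end Induced

/-- The left adjoint of the corner functor. -/
noncomputable def inductionFunctor : ModuleCat.{u} A ⥤ ModuleCat.{u} Λ :=
  Adjunction.leftAdjointOfEquiv (G := cornerFunctor ρ)
    (F_obj := fun Y => ModuleCat.of Λ (Induced ρ Y)) (Induced.homEquiv ρ) fun _ _ _ _ _ => rfl

/-- The induction functor is left adjoint to the corner functor. -/
noncomputable def inductionAdjunction : inductionFunctor ρ ⊣ cornerFunctor ρ :=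
  Adjunction.adjunctionOfEquivLeft _ _

end Corner

/-! ### Modules over the triangular matrix ring as a gluing -/

namespace TriangularMatrixRing

variable {R S M : Type u} [Ring R] [Ring S] [AddCommGroup M]
    [Module R M] [Module Sᵐᵒᵖ M] [SMulCommClass R Sᵐᵒᵖ M]

variable (R S M) in
/-- The projection to the upper left entry. -/
def aHom : TriangularMatrixRing R M S →+* R where
  toFun := a
  map_one' := rfl
  map_mul' _ _ := rfl
  map_zero' := rfl
  map_add' _ _ := rfl

variable (R S M) in
/-- The projection to the lower right entry. -/
def bHom : TriangularMatrixRing R M S →+* S where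
  toFun := b
  map_one' := rfl
  map_mul' _ _ := rfl
  map_zero' := rfl
  map_add' _ _ := rfl

variable (R S M) in
/-- The inclusion of `R` as the upper left corner. -/
def aIncl : R →ₙ+* TriangularMatrixRing R M S where
  toFun r := ⟨r, 0, 0⟩
  map_mul' _ _ := by ext <;> simp
  map_zero' := rfl
  map_add' _ _ := by ext <;> simp

variable (R S M) in
/-- The inclusion of `S` as the lower right corner. -/
def bIncl : S →ₙ+* TriangularMatrixRing R M S where
  toFun s := ⟨0, 0, s⟩
  map_mul' _ _ := by ext <;> simp
  map_zero' := rfl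
  map_add' _ _ := by ext <;> simp

@[simp] lemma aIncl_apply (r : R) : aIncl R S M r = ⟨r, 0, 0⟩ := rfl
@[simp] lemma bIncl_apply (s : S) : bIncl R S M s = ⟨0, 0, s⟩ := rfl

lemma mul_aIncl_one (x : TriangularMatrixRing R M S) : x * aIncl R S M 1 = aIncl R S M x.a := by
  ext <;> simp

lemma bIncl_one_mul (x : TriangularMatrixRing R M S) : bIncl R S M 1 * x = bIncl R S M x.b := by
  ext <;> simp

lemma aIncl_one_add_bIncl_one : aIncl R S M 1 + bIncl R S M 1 = 1 := by
  ext <;> simp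

variable (R S M) in
/-- The functor sending an `R`-module `X` to the `Λ`-module `(X, 0)`. -/
noncomputable abbrev iFunctor : ModuleCat.{u} R ⥤ ModuleCat.{u} (TriangularMatrixRing R M S) :=
  ModuleCat.restrictScalars (aHom R S M)

variable (R S M) in
/-- The functor sending an `S`-module `Y` to the `Λ`-module `(0, Y)`. -/
noncomputable abbrev jFunctor : ModuleCat.{u} S ⥤ ModuleCat.{u} (TriangularMatrixRing R M S) :=
  ModuleCat.restrictScalars (bHom R S M)

/-- Since `aIncl 1` acts as the identity on `(X, 0)`, homomorphisms `(X, 0) → N` take values in the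
upper corner of `N`. -/
noncomputable def iHomEquiv (X : ModuleCat.{u} R) (N : ModuleCat.{u} (TriangularMatrixRing R M S)) :
    ((iFunctor R S M).obj X ⟶ N) ≃ (X ⟶ (cornerFunctor (aIncl R S M)).obj N) where
  toFun f := ModuleCat.ofHom
    { toFun := fun x => Corner.mk (ρ := aIncl R S M) (f x)
        ((f.hom.map_smul (aIncl R S M 1) x).symm.trans (congr_arg f (one_smul R (x : X))))
      map_add' := fun x y => Corner.ext (map_add f.hom x y)
      map_smul' := fun r x => Corner.ext (f.hom.map_smul (aIncl R S M r) x) }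
  invFun g := ModuleCat.ofHom (X := (iFunctor R S M).obj X)
    { toFun := fun x => Corner.val (ρ := aIncl R S M) (g (x : X))
      map_add' := fun x y => congr_arg Corner.val (map_add g.hom x y)
      map_smul' := fun r x => by
        refine (congr_arg (Corner.val (ρ := aIncl R S M)) (map_smul g.hom r.a x)).trans ?_
        have key (y : Corner (aIncl R S M) N) : aIncl R S M r.a • y.val = r • y.val := by
          rw [← mul_aIncl_one, mul_smul, Corner.smul_val]
        exact key (g x) }
  left_inv _ := rfl
  right_inv _ := rfl

/-- `(X, 0)` is left adjoint to the upper corner. -/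
noncomputable def iAdjunction : iFunctor R S M ⊣ cornerFunctor (aIncl R S M) :=
  Adjunction.mkOfHomEquiv
    { homEquiv := iHomEquiv
      homEquiv_naturality_left_symm := fun _ _ => rfl
      homEquiv_naturality_right := fun _ _ => rfl }

/-- Homomorphisms `N → (0, Y)` factor through the projection of `N` to its lower corner. -/
noncomputable def jHomEquiv (N : ModuleCat.{u} (TriangularMatrixRing R M S)) (Y : ModuleCat.{u} S) :
    ((cornerFunctor (bIncl R S M)).obj N ⟶ Y) ≃ (N ⟶ (jFunctor R S M).obj Y) where
  toFun g := ModuleCat.ofHom (Y := (jFunctor R S M).obj Y)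
    { toFun := fun n => g (Corner.proj (bIncl R S M) n)
      map_add' := fun x y => by
        refine Eq.trans ?_ (map_add g.hom _ _)
        exact congr_arg g (Corner.ext (smul_add _ x y))
      map_smul' := fun r x => by
        refine Eq.trans ?_ (map_smul g.hom r.b _)
        refine congr_arg g (Corner.ext ?_)
        change bIncl R S M 1 • r • x = bIncl R S M r.b • bIncl R S M 1 • x
        rw [← mul_smul, bIncl_one_mul, ← mul_smul, Corner.map_mul_one] }
  invFun f := ModuleCat.ofHom
    { toFun := fun y => f (Corner.val (ρ := bIncl R S M) y)
      map_add' := fun x y => map_add f.hom _ _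
      map_smul' := fun s x => map_smul f.hom (bIncl R S M s) _ }
  left_inv g := by
    refine ModuleCat.hom_ext (LinearMap.ext fun (x : Corner (bIncl R S M) N) => ?_)
    exact congr_arg g (Corner.ext x.smul_val)
  right_inv f := by
    refine ModuleCat.hom_ext (LinearMap.ext fun x => ?_)
    exact (map_smul f.hom (bIncl R S M 1) x).trans (one_smul S _)

/-- The lower corner is left adjoint to `Y ↦ (0, Y)`. -/
noncomputable def jAdjunction : cornerFunctor (bIncl R S M) ⊣ jFunctor R S M :=
  Adjunction.mkOfHomEquiv
    { homEquiv := jHomEquiv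
      homEquiv_naturality_left_symm := fun _ _ => rfl
      homEquiv_naturality_right := fun _ _ => rfl }

instance : (iFunctor R S M).Full where
  map_surjective f := ⟨ModuleCat.ofHom
    { toFun := fun x => f x
      map_add' := map_add f.hom
      map_smul' := fun r x => f.hom.map_smul (aIncl R S M r) x }, rfl⟩

instance : (jFunctor R S M).Full where
  map_surjective f := ⟨ModuleCat.ofHom
    { toFun := fun x => f x
      map_add' := map_add f.hom
      map_smul' := fun r x => f.hom.map_smul (bIncl R S M r) x }, rfl⟩

variable (R S M) in
/-- The gluing of `R`-modules and `S`-modules to modules over the triangular matrix ring. -/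
noncomputable def gluing : TriangularGluing (ModuleCat.{u} R) (ModuleCat.{u} S)
    (ModuleCat.{u} (TriangularMatrixRing R M S)) where
  i := iFunctor R S M
  e := cornerFunctor (aIncl R S M)
  q := cornerFunctor (bIncl R S M)
  j := jFunctor R S M
  t := inductionFunctor (bIncl R S M)
  adjI := iAdjunction
  adjT := inductionAdjunction (bIncl R S M)
  adjJ := jAdjunction
  full_i := inferInstance
  faithful_i := inferInstance
  full_j := inferInstance
  faithful_j := inferInstance
  additive_q := inferInstance
  isSES_i := ModuleCat.isSES_restrictScalars _
  isSES_e := isSES_cornerFunctor _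
  isSES_q := isSES_cornerFunctor _
  isSES_j := ModuleCat.isSES_restrictScalars _
  isZero_q_i X := by
    have : Subsingleton (Corner (bIncl R S M) ((iFunctor R S M).obj X)) := by
      refine subsingleton_of_forall_eq 0 fun x => Corner.ext (x.smul_val.symm.trans ?_)
      exact zero_smul R (x.val : X)
    exact ModuleCat.isZero_of_subsingleton (ModuleCat.of S (Corner (bIncl R S M) _))
  isZero_e_j Y := by
    have : Subsingleton (Corner (aIncl R S M) ((jFunctor R S M).obj Y)) := by
      refine subsingleton_of_forall_eq 0 fun x => Corner.ext (x.smul_val.symm.trans ?_)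
      exact zero_smul S (x.val : Y)
    exact ModuleCat.isZero_of_subsingleton (ModuleCat.of R (Corner (aIncl R S M) _))
  isSES N := by
    refine ModuleCat.isSES_iff.2 ⟨fun x y h => Corner.ext h, fun y => ⟨Corner.val y, ?_⟩,
      fun (n : N) => ⟨fun h => ⟨Corner.mk n ?_, rfl⟩, ?_⟩⟩
    · exact Corner.ext (Corner.smul_val (ρ := bIncl R S M) (N := N) y)
    · have h : bIncl R S M 1 • n = 0 := congr_arg (Corner.val (ρ := bIncl R S M)) h
      conv_rhs => rw [← one_smul (TriangularMatrixRing R M S) n, ← aIncl_one_add_bIncl_one,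
        add_smul, h, add_zero]
    · rintro ⟨x, rfl⟩
      refine Corner.ext ?_
      have key (y : Corner (aIncl R S M) N) : bIncl R S M 1 • y.val = 0 := by
        have h : bIncl R S M 1 * aIncl R S M 1 = 0 := by ext <;> simp
        rw [← Corner.smul_val, ← mul_smul, h, zero_smul]
      exact key x

end TriangularMatrixRing

/-! ### Projective dimension of the upper corner -/

namespace TriangularMatrixRing

variable {R S M : Type u} [Ring R] [Ring S] [AddCommGroup M]
    [Module R M] [Module Sᵐᵒᵖ M] [SMulCommClass R Sᵐᵒᵖ M]

/-- The upper corner of `Λ` is `R × M`, and the upper corner of a free `Λ`-module is a direct sum of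
copies of it. -/
noncomputable def cornerFinsuppEquiv (I : Type u) :
    Corner (aIncl R S M) (I →₀ TriangularMatrixRing R M S) ≃ₗ[R] (I →₀ R × M) where
  toFun x := x.val.mapRange (fun y => (y.a, y.m)) rfl
  map_add' x y := by ext i <;> rfl
  map_smul' r x := by ext i <;> simp
  invFun x := Corner.mk (x.mapRange (fun y => ⟨y.1, y.2, 0⟩) rfl) (by ext i <;> simp)
  left_inv x := by
    refine Corner.ext ?_
    conv_rhs => rw [← Corner.smul_val]
    ext i <;> simp
  right_inv x := by ext i <;> rfl

lemma hasProjectiveDimensionLE_prod {A : Type u} [Ring A] (X : Type u) [AddCommGroup X] [Module A X]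
    (n : ℕ) (hX : HasProjectiveDimensionLE (ModuleCat.of A X) n) :
    HasProjectiveDimensionLE (ModuleCat.of A (A × X)) n := by
  have h : IsSES (ModuleCat.ofHom (LinearMap.inl A A X)) (ModuleCat.ofHom (LinearMap.snd A A X)) :=
    ModuleCat.isSES_iff.2 ⟨LinearMap.inl_injective, LinearMap.snd_surjective,
      Function.Exact.inl_snd⟩
  have : Projective (ModuleCat.of A A) := (IsProjective.iff_projective (R := A) A).1 inferInstance
  exact h.shortExact.hasProjectiveDimensionLT_X₂ (n + 1)
    (hasProjectiveDimensionLT_of_ge _ 1 _ (by omega)) hX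

/-- The upper corner of a projective `Λ`-module is a summand of a direct sum of copies of `R × M`.
-/
lemma hasProjectiveDimensionLE_corner (n : ℕ)
    (hM : HasProjectiveDimensionLE (ModuleCat.of R M) n)
    (Q : ModuleCat.{u} (TriangularMatrixRing R M S)) [Projective Q] :
    HasProjectiveDimensionLE ((cornerFunctor (aIncl R S M)).obj Q) n := by
  let F := ModuleCat.of (TriangularMatrixRing R M S) (Q →₀ TriangularMatrixRing R M S)
  let p : F ⟶ Q := ModuleCat.ofHom (Finsupp.linearCombination _ id)
  have : Epi p := (ModuleCat.epi_iff_surjective p).2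
    (Finsupp.linearCombination_id_surjective _ _)
  let r : Retract Q F := ⟨Projective.factorThru (𝟙 Q) p, p, Projective.factorThru_comp _ _⟩
  have hF : HasProjectiveDimensionLE ((cornerFunctor (aIncl R S M)).obj F) n :=
    have := ModuleCat.hasProjectiveDimensionLE_finsupp Q n _ (hasProjectiveDimensionLE_prod M n hM)
    hasProjectiveDimensionLT_of_iso (cornerFinsuppEquiv (Q : Type u)).toModuleIso.symm _
  exact (r.map (cornerFunctor (aIncl R S M))).hasProjectiveDimensionLT _

end TriangularMatrixRing

/-! ### Character modules -/

section Dual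

variable {A : Type u} [Ring A]

/-- The character module of a right `A`-module is a left `A`-module, with
`(a c) x = c (x a)`. -/
instance CharacterModule.moduleOfRight (U : Type u) [AddCommGroup U] [Module Aᵐᵒᵖ U] :
    Module A (CharacterModule U) where
  smul a c := AddMonoidHom.comp (c : U →+ _) (DistribSMul.toAddMonoidHom U (MulOpposite.op a))
  one_smul c := CharacterModule.ext _ fun x => congr_arg c (one_smul Aᵐᵒᵖ x)
  mul_smul a b c := CharacterModule.ext _ fun x => congr_arg c (mul_smul (MulOpposite.op b)
    (MulOpposite.op a) x)
  smul_zero _ := rfl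
  smul_add _ _ _ := rfl
  add_smul a b c := CharacterModule.ext _ fun x =>
    (congr_arg c (add_smul (MulOpposite.op a) (MulOpposite.op b) x)).trans (map_add c _ _)
  zero_smul c := CharacterModule.ext _ fun x =>
    (congr_arg c (zero_smul Aᵐᵒᵖ x)).trans (map_zero c)

lemma CharacterModule.exists_extension {X Y : Type u} [AddCommGroup X] [AddCommGroup Y] (f : X →+ Y)
    (hf : Function.Injective f) (c : CharacterModule X) :
    ∃ d : CharacterModule Y, ∀ x, d (f x) = c x := by
  obtain ⟨d, hd⟩ := CharacterModule.dual_surjective_of_injective (R := ℤ) f.toIntLinearMap hf c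
  exact ⟨d, fun x => DFunLike.congr_fun hd x⟩

/-- Lambek's theorem: the character module of a flat right module is injective, since homomorphisms
`X → CharacterModule U` are characters of `U ⊗ X`. -/
lemma IsFlatRightModule.injective_characterModule {U : Type u} [AddCommGroup U] [Module Aᵐᵒᵖ U]
    (hU : IsFlatRightModule A U) : Injective (ModuleCat.of A (CharacterModule U)) := by
  refine ⟨fun {X Y} g f hf => ?_⟩
  let gl : X →ₗ[A] CharacterModule U := g.hom
  have balanced : balancedRelations A U X ≤
      (TensorProduct.liftAddHom (gl.toAddMonoidHom.flip) fun n u x => by simp).ker := by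
    rw [balancedRelations, AddSubgroup.closure_le]
    rintro _ ⟨u, a, x, rfl⟩
    have : gl x (MulOpposite.op a • u) = gl (a • x) u :=
      (DFunLike.congr_fun (map_smul gl a x) u).symm
    simp only [SetLike.mem_coe, AddMonoidHom.mem_ker, map_sub, sub_eq_zero]
    exact this
  obtain ⟨d, hd⟩ := CharacterModule.exists_extension (BalancedTensor.map U f.hom)
    (hU X Y f.hom ((ModuleCat.mono_iff_injective f).1 hf)) (QuotientAddGroup.lift _ _ balanced)
  let tmul : U → Y → BalancedTensor A U Y := fun u y => QuotientAddGroup.mk (u ⊗ₜ[ℤ] y)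
  have tmul_smul (a : A) (u : U) (y : Y) : tmul u (a • y) = tmul (MulOpposite.op a • u) y :=
    QuotientAddGroup.eq_iff_sub_mem.2 (neg_mem_iff.1 (by
      rw [neg_sub]
      exact AddSubgroup.subset_closure ⟨u, a, y, rfl⟩))
  have tmul_add (u : U) (y z : Y) : tmul u (y + z) = tmul u y + tmul u z :=
    congr_arg QuotientAddGroup.mk (TensorProduct.tmul_add u y z)
  have add_tmul (u v : U) (y : Y) : tmul (u + v) y = tmul u y + tmul v y :=
    congr_arg QuotientAddGroup.mk (TensorProduct.add_tmul u v y)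
  let l : Y →ₗ[A] CharacterModule U :=
    { toFun := fun y => AddMonoidHom.mk' (fun u => d (tmul u y)) fun u v => by
        rw [add_tmul, map_add]
      map_add' := fun y z => CharacterModule.ext _ fun u =>
        (congr_arg d (tmul_add u y z)).trans (map_add d _ _)
      map_smul' := fun a y => CharacterModule.ext _ fun u => congr_arg d (tmul_smul a u y) }
  refine ⟨ModuleCat.ofHom l, ModuleCat.hom_ext (LinearMap.ext fun x =>
    CharacterModule.ext _ fun u => ?_)⟩
  exact hd (QuotientAddGroup.mk (u ⊗ₜ[ℤ] x))

/-- A character `c` of a left module `X` corresponds to the homomorphism `x ↦ (a ↦ c (a x))` to the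
character module of the ring. -/
def ModuleCat.toCharacterModule {X : ModuleCat.{u} A} (c : CharacterModule X) :
    X ⟶ ModuleCat.of A (CharacterModule A) :=
  ModuleCat.ofHom
    { toFun := fun x => AddMonoidHom.mk' (fun a => c (a • x)) fun a b => by rw [add_smul, map_add]
      map_add' := fun x y => CharacterModule.ext _ fun a =>
        (congr_arg c (smul_add a x y)).trans (map_add c _ _)
      map_smul' := fun b x => CharacterModule.ext _ fun a => congr_arg c (mul_smul a b x).symm }

lemma ModuleCat.toCharacterModule_apply_one {X : ModuleCat.{u} A} (c : CharacterModule X) (x : X) :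
    ((toCharacterModule c).hom x : CharacterModule A) 1 = c x :=
  congr_arg c (one_smul A x)

lemma injective_characterModule_self : Injective (ModuleCat.of A (CharacterModule A)) := by
  refine ⟨fun {X Y} g f hf => ?_⟩
  let c : CharacterModule X :=
    { toFun := fun x => (g x : CharacterModule A) 1
      map_zero' := by rw [map_zero]; rfl
      map_add' := fun x y => by rw [map_add]; rfl }
  obtain ⟨d, hd⟩ := CharacterModule.exists_extension f.hom.toAddMonoidHom
    ((ModuleCat.mono_iff_injective f).1 hf) c
  refine ⟨ModuleCat.toCharacterModule d, ModuleCat.hom_ext (LinearMap.ext fun x =>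
    CharacterModule.ext _ fun a => ?_)⟩
  refine (congr_arg d (map_smul f.hom a x).symm).trans ((hd _).trans ?_)
  change (g.hom (a • x) : CharacterModule A) 1 = (g.hom x : CharacterModule A) a
  rw [map_smul]
  exact congr_arg (g.hom x : CharacterModule A) (one_mul a)

/-- Dualizing `0 → ker p → U → V → 0` gives a short exact sequence of character modules. -/
lemma isSES_characterModule {U V : Type u} [AddCommGroup U] [Module Aᵐᵒᵖ U] [AddCommGroup V]
    [Module Aᵐᵒᵖ V] (p : U →ₗ[Aᵐᵒᵖ] V) (hp : Function.Surjective p) :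
    ∃ (f : ModuleCat.of A (CharacterModule V) ⟶ ModuleCat.of A (CharacterModule U))
      (g : ModuleCat.of A (CharacterModule U) ⟶
        ModuleCat.of A (CharacterModule (LinearMap.ker p))), IsSES f g := by
  let f : CharacterModule V →ₗ[A] CharacterModule U :=
    { toFun := fun c => AddMonoidHom.comp (c : V →+ _) p.toAddMonoidHom
      map_add' := fun _ _ => rfl
      map_smul' := fun a c => CharacterModule.ext _ fun u =>
        congr_arg c (map_smul p (MulOpposite.op a) u).symm }
  let g : CharacterModule U →ₗ[A] CharacterModule (LinearMap.ker p) :=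
    { toFun := fun c => AddMonoidHom.comp (c : U →+ _) (LinearMap.ker p).subtype.toAddMonoidHom
      map_add' := fun _ _ => rfl
      map_smul' := fun _ _ => rfl }
  refine ⟨ModuleCat.ofHom f, ModuleCat.ofHom g, ModuleCat.isSES_iff.2
    ⟨fun c d h => CharacterModule.ext _ fun v => ?_, fun c => ?_, fun c => ⟨fun h => ?_, ?_⟩⟩⟩
  · obtain ⟨u, rfl⟩ := hp v
    exact DFunLike.congr_fun (F := CharacterModule U) h u
  · obtain ⟨d, hd⟩ := CharacterModule.exists_extension
      (LinearMap.ker p).subtype.toAddMonoidHom Subtype.val_injective c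
    exact ⟨d, CharacterModule.ext _ hd⟩
  · have hc : p.toAddMonoidHom.ker ≤ AddMonoidHom.ker (c : U →+ _) := fun u hu =>
      have hu' : (c : CharacterModule U) u = 0 :=
        DFunLike.congr_fun (F := CharacterModule (LinearMap.ker p)) h ⟨u, hu⟩
      hu'
    exact ⟨p.toAddMonoidHom.liftOfSurjective hp ⟨c, hc⟩, CharacterModule.ext _ fun u =>
      p.toAddMonoidHom.liftOfRightInverse_comp_apply _ (Function.rightInverse_surjInv hp) ⟨c, hc⟩ u⟩
  · rintro ⟨d, rfl⟩
    exact CharacterModule.ext _ fun u => (congr_arg d u.2).trans (map_zero d)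

lemma HasFlatDimensionLE.hasInjectiveDimensionLE (n : ℕ) (U : Type u) [AddCommGroup U]
    [Module Aᵐᵒᵖ U] (hU : HasFlatDimensionLE A n U) :
    HasInjectiveDimensionLE (ModuleCat.of A (CharacterModule U)) n := by
  induction n generalizing U with
  | zero =>
    have := IsFlatRightModule.injective_characterModule hU
    exact injective_iff_hasInjectiveDimensionLT_one.1 this
  | succ n ih =>
    obtain ⟨F, _, _, p, hF, hp, hK⟩ := hU
    obtain ⟨f, g, h⟩ := isSES_characterModule p hp
    exact (h.shortExact.hasInjectiveDimensionLT_X₃_iff n hF.injective_characterModule).1 (ih _ hK)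

end Dual

/-! ### Exactness of induction from the finite flat dimension of the bimodule -/

namespace TriangularMatrixRing

variable {R S M : Type u} [Ring R] [Ring S] [AddCommGroup M]
    [Module R M] [Module Sᵐᵒᵖ M] [SMulCommClass R Sᵐᵒᵖ M]

variable (R S M) in
/-- The character module of `Λ`, as a left `Λ`-module. -/
abbrev characterModule : ModuleCat.{u} (TriangularMatrixRing R M S) :=
  ModuleCat.of _ (CharacterModule (TriangularMatrixRing R M S))

/-- The lower corner of the character module of `Λ` is an extension of the character module of `M`
by that of `S`. -/
lemma hasInjectiveDimensionLE_corner (n : ℕ) (hM : HasFlatDimensionLE S n M) :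
    HasInjectiveDimensionLE ((cornerFunctor (bIncl R S M)).obj (characterModule R S M)) n := by
  let f : CharacterModule S →ₗ[S] Corner (bIncl R S M) (characterModule R S M) :=
    { toFun := fun c => Corner.mk (N := characterModule R S M)
        (AddMonoidHom.mk' (fun x => c x.b) fun x y => map_add c x.b y.b)
        (CharacterModule.ext _ fun x => congr_arg c (mul_one x.b))
      map_add' := fun _ _ => rfl
      map_smul' := fun _ _ => rfl }
  let g : Corner (bIncl R S M) (characterModule R S M) →ₗ[S] CharacterModule M :=
    { toFun := fun c => AddMonoidHom.mk'
        (fun m => (c.val : CharacterModule (TriangularMatrixRing R M S)) ⟨0, m, 0⟩) fun m m' => by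
          rw [← map_add]
          congr 1
          ext <;> simp
      map_add' := fun _ _ => rfl
      map_smul' := fun s c => CharacterModule.ext _ fun m =>
        congr_arg (c.val : CharacterModule (TriangularMatrixRing R M S))
          (by ext <;> simp : (⟨0, m, 0⟩ : TriangularMatrixRing R M S) * bIncl R S M s =
            ⟨0, MulOpposite.op s • m, 0⟩) }
  have h : IsSES (ModuleCat.ofHom f) (ModuleCat.ofHom g) := by
    refine ModuleCat.isSES_iff.2 ⟨fun c d h => CharacterModule.ext _ fun s => ?_, fun c => ?_,
      fun (c : Corner (bIncl R S M) (characterModule R S M)) => ⟨fun h => ?_, ?_⟩⟩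
    · exact DFunLike.congr_fun (F := CharacterModule (TriangularMatrixRing R M S))
        (congr_arg Corner.val h) ⟨0, 0, s⟩
    · refine ⟨Corner.mk (N := characterModule R S M)
        (AddMonoidHom.mk' (fun x => c x.m) fun x y => map_add c x.m y.m)
        (CharacterModule.ext _ fun x => congr_arg c ?_), rfl⟩
      change x.a • (0 : M) + MulOpposite.op (1 : S) • x.m = x.m
      simp
    · let d : CharacterModule (TriangularMatrixRing R M S) := c.val
      have hd (x) : d (x * bIncl R S M 1) = d x := DFunLike.congr_fun c.smul_val x
      have hd' (m : M) : d ⟨0, m, 0⟩ = 0 := DFunLike.congr_fun (F := CharacterModule M) h m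
      refine ⟨AddMonoidHom.mk' (fun s => d ⟨0, 0, s⟩) fun s s' => ?_,
        Corner.ext (CharacterModule.ext _ fun x => ?_)⟩
      · rw [← map_add]
        congr 1
        ext <;> simp
      · change d ⟨0, 0, x.b⟩ = d x
        rw [← hd x, ← zero_add (d ⟨0, 0, x.b⟩), ← hd' x.m, ← map_add]
        congr 1
        ext <;> simp
    · rintro ⟨d, rfl⟩
      exact CharacterModule.ext _ fun m => map_zero d
  have := injective_characterModule_self (A := S)
  exact h.shortExact.hasInjectiveDimensionLT_X₂ (n + 1)
    (hasInjectiveDimensionLT_of_ge _ 1 _ (by omega)) hM.hasInjectiveDimensionLE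

/-- Induction from `S` to `Λ` keeps `f` injective if `Ext¹` vanishes from the cokernel of `f` to the
lower corner of the character module of `Λ`. Characters of the induced module are homomorphisms to
the character module of `Λ`, which by adjunction correspond to homomorphisms to its lower corner;
these extend along `f`, so every element of the kernel of the induced map is killed by all
characters. -/
lemma mono_induction_map {X Y Z : ModuleCat.{u} S} {f : X ⟶ Y} {g : Y ⟶ Z} (h : IsSES f g)
    (hZ : Subsingleton (Abelian.Ext.{u} Z
      ((cornerFunctor (bIncl R S M)).obj (characterModule R S M)) 1)) :
    Mono ((inductionFunctor (bIncl R S M)).map f) := by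
  rw [ModuleCat.mono_iff_injective, injective_iff_map_eq_zero]
  intro x hx
  by_contra hx0
  obtain ⟨c, hc⟩ := CharacterModule.exists_character_apply_ne_zero_of_ne_zero hx0
  let Φ := ModuleCat.toCharacterModule c
  let adj := inductionAdjunction (bIncl R S M)
  obtain ⟨l, hl⟩ := h.exists_extension (adj.homEquiv _ _ Φ)
  have hΦ : (inductionFunctor (bIncl R S M)).map f ≫ (adj.homEquiv _ _).symm l = Φ := by
    rw [← adj.homEquiv_naturality_left_symm, hl, Equiv.symm_apply_apply]
  refine hc ?_
  rw [← ModuleCat.toCharacterModule_apply_one c x]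
  change (Φ x : CharacterModule (TriangularMatrixRing R M S)) 1 = 0
  rw [← hΦ, ModuleCat.comp_apply, hx, map_zero]
  rfl

lemma isCompatible_gluing (hpd : ∃ n : ℕ, HasProjectiveDimensionLE (ModuleCat.of R M) n)
    (hfd : ∃ n : ℕ, HasFlatDimensionLE S n M) : (gluing R S M).IsCompatible where
  e_projective Q _ := hpd.imp fun n hn => hasProjectiveDimensionLE_corner n hn Q
  t_mono h hZ := by
    obtain ⟨n, hn⟩ := hfd
    have := hasInjectiveDimensionLE_corner (R := R) n hn
    exact mono_induction_map h (ext_gorensteinProjective_of_hasInjectiveDimensionLE hZ n 0)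

end TriangularMatrixRing

theorem corollary1p2 {R S M : Type u} [Ring R] [Ring S] [AddCommGroup M]
    [Module R M] [Module Sᵐᵒᵖ M] [SMulCommClass R Sᵐᵒᵖ M]
    (hpd : ∃ n : ℕ, HasProjectiveDimensionLE (ModuleCat.of R M) n)
    (hfd : ∃ n : ℕ, HasFlatDimensionLE S n M) :
    IsSpecialPrecovering (gorensteinProjective (ModuleCat.{u} (TriangularMatrixRing R M S))) ↔
      IsSpecialPrecovering (gorensteinProjective (ModuleCat.{u} R)) ∧
        IsSpecialPrecovering (gorensteinProjective (ModuleCat.{u} S)) :=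
  TriangularGluing.isSpecialPrecovering_iff (TriangularMatrixRing.isCompatible_gluing hpd hfd)
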